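/- **Setting.** Let $N\ge 2$. A leader $\dot x_1=f(x_1,\theta)$ and followers $\dot x_i=f(x_i,\theta)+Bu_i$ ($i=2,\dots,N$) have states in $\mathbb R^n$, with $\theta,\hat\theta\in\Omega\subset\mathbb R^p$ ($\hat\theta$ is an a-priori estimate of $\theta$), $f:\mathbb R^n\times\Omega\to\mathbb R^n$ of class $C^1$ and $B\in\mathbb R^{n\times m}$. The communication graph is undirected and connected, with symmetric weights $a_{ij}\ge 0$ ($a_{ij}>0$ exactly on the edges, no loops) and Laplacian $L=(l_{ij})$, $l_{ij}=-a_{ij}$ for $i\ne j$, $l_{ii}=\sum_k a_{ik}$. Let $\mu>0$ satisfy $L_{22}\ge\mu I$, where $L_{22}$ is $L$ without the row and the column of the leader. Assume that there are a symmetric positive definite $P$ and $q,\rho>0$ with $$\frac{\partial f}{\partial x}(x,\theta')^\top P+P\frac{\partial f}{\partial x}(x,\theta')-\rho PBB^\top P\le -qP\qquad(x\in\mathbb R^n,\ \theta'\in\Omega),$$ and that $|f(x,\theta')-f(y,\theta')|\le k|x-y|$ for all $x,y\in\mathbb R^n$, $\theta'\in\Omega$, and $|f(x,\hat\theta)-f(x,\theta)|\le\Delta$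 for all $x\in\mathbb R^n$, where $k>0$, $\Delta\ge0$. **Control and communication.** Every agent $i$ keeps estimates $\hat x^i_j$ of its neighbours' states and of its own ($j=i$), which follow $\dot{\hat x}{}^i_j=f(\hat x^i_j,\hat\theta)$ and are reset to $\hat x^i_j=x_j$ whenever agent $j$ communicates. The input is $u_i=-\kappa\sum_j l_{ij}B^\top P\hat x^i_j$ for $i=2,\dots,N$, where $\kappa=\kappa_1+\kappa_2$, $\kappa_1>\rho/(2\mu)$, $\kappa_2>0$. Put $e_i=x_i-\hat x^i_i$, $w_i=\sum_j l_{ij}(\hat x^i_i-\hat x^i_j)$, $M_i=\sum_j l_{ij}^2$, $R_i=2\kappa PBB^\top P$, $\Theta_i=2\kappa_2\varepsilon(1-2l_{ii}b_i)PBB^\top P$, $$S_i=\Big(2\kappa l_{ii}b_i+\frac{2\kappa l_{ii}}{b_i}+\kappa_2\varepsilon\Big(\frac{4l_{ii}}{b_i}+NM_i\Big(\frac{b_i}{2}+\frac1{2b_i}\Big)\Big)\Big)PBB^\top P,$$ and $\delta_i=e_i^\top S_ie_i+|w_i^\top R_ie_i|$, where $0\le\varepsilon\le1/\lambda_{\max}(L)$,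 $0<b_i<1/(2l_{ii})$, $0<\sigma_i<1$ and $\xi>0$. Every agent communicates at time $t_{i,0}=0$, and then at $$t_{i,r+1}=\inf\{s>t_{i,r}\mid \delta_i(s)-\sigma_iw_i(s)^\top\Theta_iw_i(s)-\xi>0\},$$ where the condition is evaluated as long as agent $i$ has not communicated again ($t_{i,r+1}=\infty$ if it is never met). **Theorem.** For every $\mathbf x(0)\in\mathbb R^{nN}$ the closed loop has a solution. Every solution $\mathbf x=(x_1,\dots,x_N)$ is defined for all $t\ge0$, with finitely many communications in every bounded time interval (no Zeno behaviour), and $$\limsup_{t\to\infty}|\mathbf x(t)|_{\mathcal D}^2\le\frac{N\xi}{q\,\lambda_{\min}(P)},$$ where $|\cdot|_{\mathcal D}$ is the Euclidean distance to $\mathcal D=\{x_1=\dots=x_N\}$. For each $i$ the supremum $w_{i,\max}$ of $|w_i|$ along the solution (the values before, between and after simultaneous communications included) is finite. Put $$\nu_i=\frac{\kappa|BB^\top P|\,w_{i,\max}+\Delta}{k},\qquad c_1=|S_i|\nu_i^2,\qquad c_2=w_{i,\max}|R_i|\nu_i,$$ with the matrix norm induced by the Euclidean norm. If $c_1>0$,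 any two communication times of agent $i$ differ by at least $$\tau_i=\frac1k\log\left(\sqrt{\frac{\xi}{c_1}+\frac{c_2^2}{4c_1^2}}+1-\frac{c_2}{2c_1}\right)>0;$$ if $c_1=0$, agent $i$ does not communicate after time $0$. -/

import Mathlib

open Set Filter Topology

noncomputable section

namespace LeaderFollower

/-- Euclidean space `ℝⁿ`. -/
abbrev Vec (n : ℕ) := EuclideanSpace ℝ (Fin n)

/-- Stacked states `col(x₁, …, x_N)` of `N = M + 1` agents in `ℝⁿ`, with the Euclidean norm of
`ℝ^{nN}`. Agent `0` is the leader, agents `1, …, M` are the followers. -/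
abbrev Config (n M : ℕ) := PiLp 2 (fun _ : Fin (M + 1) => Vec n)

/-- The consensus manifold `x₁ = ⋯ = x_N`. -/
def consensus (n M : ℕ) : Set (Config n M) := {x | ∀ i j, x i = x j}

/-- The Euclidean distance `|x|_𝒟` to the consensus manifold. -/
def distConsensus {n M : ℕ} (x : Config n M) : ℝ := Metric.infDist x (consensus n M)

/-- The smallest (real) eigenvalue of a matrix. -/
def lambdaMin {ι : Type} [Fintype ι] [DecidableEq ι] (A : Matrix ι ι ℝ) : ℝ :=
  sInf (spectrum ℝ A)

/-- The largest (real) eigenvalue of a matrix. -/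
def lambdaMax {ι : Type} [Fintype ι] [DecidableEq ι] (A : Matrix ι ι ℝ) : ℝ :=
  sSup (spectrum ℝ A)

/-- The matrix norm induced by the Euclidean norm. -/
def opNorm {n : ℕ} (A : Matrix (Fin n) (Fin n) ℝ) : ℝ :=
  ‖Matrix.toEuclideanCLM (n := Fin n) (𝕜 := ℝ) A‖

/-- The number `vᵀ A w`. -/
def bilin {n : ℕ} (A : Matrix (Fin n) (Fin n) ℝ) (v w : Vec n) : ℝ :=
  v.ofLp ⬝ᵥ (A.mulVec w.ofLp)

/-- The Jacobian matrix of `g : ℝⁿ → ℝⁿ` at `x`. -/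
def jacobian {n : ℕ} (g : Vec n → Vec n) (x : Vec n) : Matrix (Fin n) (Fin n) ℝ :=
  Matrix.of fun i j => (fderiv ℝ g x (EuclideanSpace.single j 1)) i

/-- The weighted Laplacian: `l_ij = -a_ij` for `i ≠ j` and `l_ii = ∑ₖ a_ik`. -/
def laplacian {ι : Type} [Fintype ι] [DecidableEq ι] (a : Matrix ι ι ℝ) : Matrix ι ι ℝ :=
  Matrix.of fun i j => if i = j then ∑ k, a i k else - a i j

/-- The data of the multi-agent system: vector field, true parameter `θ` and its a-priori estimate
`θhat`, input matrix, weighted adjacency matrix, and the design parameters of the control law and of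
the communication triggering condition. -/
structure System (n m p M : ℕ) where
  /-- vector field `f(x, θ)` -/
  f : Vec n → Vec p → Vec n
  /-- true parameter -/
  θ : Vec p
  /-- a-priori estimate of the parameter -/
  θhat : Vec p
  /-- input matrix -/
  B : Matrix (Fin n) (Fin m) ℝ
  /-- adjacency matrix -/
  a : Matrix (Fin (M + 1)) (Fin (M + 1)) ℝ
  /-- matrix of the metric -/
  P : Matrix (Fin n) (Fin n) ℝ
  /-- first gain -/
  κ₁ : ℝ
  /-- second gain -/
  κ₂ : ℝ
  /-- parameter of `Θᵢ` and `Sᵢ` -/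
  ε : ℝ
  /-- parameters `bᵢ` of `Θᵢ` and `Sᵢ` -/
  b : Fin (M + 1) → ℝ
  /-- parameters `σᵢ` of the triggering condition -/
  σ : Fin (M + 1) → ℝ
  /-- threshold of the triggering condition -/
  ξ : ℝ

/-- Instantaneous state of the closed loop: the states `xᵢ` and the estimates, `est i j` being the
estimate of the state of agent `j` held by agent `i`. (Estimates with `j ≠ i` not a neighbour
of `i` are carried along for uniformity; they are always multiplied by the weight `l_ij = 0`.) -/
structure State (n M : ℕ) where
  /-- the states of the agents -/
  x : Config n M
  /-- the estimates held by the agents -/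
  est : Fin (M + 1) → Fin (M + 1) → Vec n

namespace System

variable {n m p M : ℕ} (S : System n m p M)

/-- The Laplacian of the communication graph. -/
def L : Matrix (Fin (M + 1)) (Fin (M + 1)) ℝ := laplacian S.a

/-- `κ = κ₁ + κ₂`. -/
def κ : ℝ := S.κ₁ + S.κ₂

/-- `α(x) = Bᵀ P x`. -/
def α (x : Vec n) : Vec m := Matrix.toEuclideanLin (S.B.transpose * S.P) x

/-- The distributed control law `uᵢ = -κ ∑ⱼ l_ij α(x̂ⱼⁱ)` of the followers; the leader has no
input. -/
def control (z : State n M) (i : Fin (M + 1)) : Vec m :=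
  if i = 0 then 0 else (-S.κ) • ∑ j, S.L i j • S.α (z.est i j)

/-- `P B Bᵀ P`. -/
def Q : Matrix (Fin n) (Fin n) ℝ := S.P * S.B * S.B.transpose * S.P

/-- `R = 2 κ P B Bᵀ P`. -/
def R : Matrix (Fin n) (Fin n) ℝ := (2 * S.κ) • S.Q

/-- `Θᵢ = 2 κ₂ ε (1 - 2 l_ii bᵢ) P B Bᵀ P`. -/
def Θ (i : Fin (M + 1)) : Matrix (Fin n) (Fin n) ℝ :=
  (2 * S.κ₂ * S.ε * (1 - 2 * S.L i i * S.b i)) • S.Q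

/-- `Sᵢ = (2 κ l_ii bᵢ + 2 κ l_ii / bᵢ + κ₂ ε (4 l_ii / bᵢ + N Mᵢ (bᵢ/2 + 1/(2 bᵢ)))) P B Bᵀ P`
with `Mᵢ = ∑ⱼ l_ij²` and `N = M + 1` agents. -/
def Smat (i : Fin (M + 1)) : Matrix (Fin n) (Fin n) ℝ :=
  (2 * S.κ * S.L i i * S.b i + 2 * S.κ * S.L i i / S.b i
    + S.κ₂ * S.ε * (4 * S.L i i / S.b i
      + ((M : ℝ) + 1) * (∑ j, S.L i j ^ 2) * (S.b i / 2 + 1 / (2 * S.b i)))) • S.Q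

/-- The error `eᵢ = xᵢ - x̂ᵢⁱ`. -/
def err (z : State n M) (i : Fin (M + 1)) : Vec n := z.x i - z.est i i

/-- `wᵢ = ∑ⱼ l_ij (x̂ᵢⁱ - x̂ⱼⁱ)`. -/
def w (z : State n M) (i : Fin (M + 1)) : Vec n := ∑ j, S.L i j • (z.est i i - z.est i j)

/-- `δᵢ = eᵢᵀ Sᵢ eᵢ + |wᵢᵀ R eᵢ|`. -/
def δ (z : State n M) (i : Fin (M + 1)) : ℝ :=
  bilin (S.Smat i) (err z i) (err z i) + |bilin S.R (S.w z i) (err z i)|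

/-- The quantity `δᵢ - σᵢ wᵢᵀ Θᵢ wᵢ - ξ`, whose positivity makes agent `i` communicate. -/
def trigger (z : State n M) (i : Fin (M + 1)) : ℝ :=
  S.δ z i - S.σ i * bilin (S.Θ i) (S.w z i) (S.w z i) - S.ξ

/-- `z` evolves on `[t₀, ∞)` without any communication: the agents follow
`ẋᵢ = f(xᵢ, θ) + B uᵢ` (with no input for the leader), and the estimates follow
`d/dt x̂ⱼⁱ = f(x̂ⱼⁱ, θhat)`. -/
def IsFlow (z : ℝ → State n M) (t₀ : ℝ) : Prop :=
  (∀ t, t₀ ≤ t → ∀ i, HasDerivWithinAt (fun s => (z s).x i)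
      (S.f ((z t).x i) S.θ + Matrix.toEuclideanLin S.B (S.control (z t) i)) (Ici t₀) t) ∧
  (∀ t, t₀ ≤ t → ∀ i j, HasDerivWithinAt (fun s => (z s).est i j)
      (S.f ((z t).est i j) S.θhat) (Ici t₀) t)

/-- `inf {s > t₀ | δᵢ(s) - σᵢ wᵢ(s)ᵀ Θᵢ wᵢ(s) - ξ > 0}` along `z`; it is `⊤` if the set is empty. -/
def triggerTime (z : ℝ → State n M) (t₀ : ℝ) (i : Fin (M + 1)) : EReal :=
  sInf ((fun s : ℝ => (s : EReal)) '' {s : ℝ | t₀ < s ∧ 0 < S.trigger (z s) i})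

end System

open Classical in
/-- The agents in `C` broadcast their states: all estimates of these states are reset. -/
def broadcast {n M : ℕ} (C : Set (Fin (M + 1))) (z : State n M) : State n M where
  x := z.x
  est i j := if j ∈ C then z.x j else z.est i j

/-- A solution of the event-triggered closed loop from the initial state `x₀`.

`time k` is the time of the `k`-th communication event (`⊤` if there is none), `comm k` the set of
the agents that communicate at this event, and `flow k` the evolution of the closed loop after it as
long as nobody communicates. At time `0` every agent communicates. The next event occurs as soon as
the triggering condition of some agent is met along `flow k`, and exactly the agents whose
triggering time is that instant communicate. So the solution follows `flow k` on
`[time k, time (k + 1)]`, and the inter-event evolution is continued virtually beyond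
`time (k + 1)` only to evaluate the infimum. Since a received message changes `wⱼ`
discontinuously, it may make agent `j` communicate at the same instant: then
`time (k + 1) = time k`. -/
structure Solution {n m p M : ℕ} (S : System n m p M) (x₀ : Config n M) where
  /-- event times -/
  time : ℕ → EReal
  /-- communicating agents -/
  comm : ℕ → Set (Fin (M + 1))
  /-- evolutions after the events -/
  flow : ℕ → ℝ → State n M
  time_zero : time 0 = ((0 : ℝ) : EReal)
  comm_zero : comm 0 = univ
  init : (flow 0 0).x = x₀
  init_est : ∀ i j, (flow 0 0).est i j = x₀ j
  isFlow : ∀ (k : ℕ) (t : ℝ), time k = (t : EReal) → S.IsFlow (flow k) t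
  time_succ : ∀ (k : ℕ) (t : ℝ), time k = (t : EReal) →
    time (k + 1) = ⨅ i, S.triggerTime (flow k) t i
  comm_succ : ∀ (k : ℕ) (t t' : ℝ), time k = (t : EReal) → time (k + 1) = (t' : EReal) →
    comm (k + 1) = {i | S.triggerTime (flow k) t i = (t' : EReal)}
  reset : ∀ (k : ℕ) (t' : ℝ), time (k + 1) = (t' : EReal) →
    flow (k + 1) t' = broadcast (comm (k + 1)) (flow k t')
  time_top : ∀ k, time k = ⊤ → time (k + 1) = ⊤
  comm_top : ∀ k, time k = ⊤ → comm k = ∅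

namespace Solution

variable {n m p M : ℕ} {S : System n m p M} {x₀ : Config n M} (Z : Solution S x₀)

/-- `x : ℝ → ℝ^{nN}` is the state trajectory of the solution on all of `[0, ∞)`; in particular every
`t ≥ 0` lies between two successive events, so that events do not accumulate. -/
def IsTrajectory (x : ℝ → Config n M) : Prop :=
  ∀ t : ℝ, 0 ≤ t → ∃ k, Z.time k ≤ (t : EReal) ∧ (t : EReal) < Z.time (k + 1) ∧
    x t = (Z.flow k t).x

/-- All values taken by `|wᵢ|` along the solution, the values just before and between
simultaneous communications included. -/
def wValues (i : Fin (M + 1)) : Set ℝ :=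
  {r | ∃ (k : ℕ) (t : ℝ), Z.time k ≤ (t : EReal) ∧ (t : EReal) ≤ Z.time (k + 1) ∧
    r = ‖S.w (Z.flow k t) i‖}

/-- `w_{i,max}`, the supremum of `|wᵢ|` along the solution. -/
def wMax (i : Fin (M + 1)) : ℝ := sSup (Z.wValues i)

/-- `ν = (κ |B Bᵀ P| w_{i,max} + Δ) / k`. -/
def ν (k Δ : ℝ) (i : Fin (M + 1)) : ℝ :=
  (S.κ * opNorm (S.B * S.B.transpose * S.P) * Z.wMax i + Δ) / k

/-- `c₁ = |Sᵢ| ν²`. -/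
def c₁ (k Δ : ℝ) (i : Fin (M + 1)) : ℝ := opNorm (S.Smat i) * Z.ν k Δ i ^ 2

/-- `c₂ = w_{i,max} |R| ν`. -/
def c₂ (k Δ : ℝ) (i : Fin (M + 1)) : ℝ := Z.wMax i * opNorm S.R * Z.ν k Δ i

/-- `τᵢ = (1/k) log (√(ξ/c₁ + c₂²/(4c₁²)) + 1 - c₂/(2c₁))`. -/
def τ (k Δ : ℝ) (i : Fin (M + 1)) : ℝ :=
  1 / k * Real.log (Real.sqrt (S.ξ / Z.c₁ k Δ i + Z.c₂ k Δ i ^ 2 / (4 * Z.c₁ k Δ i ^ 2)) + 1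
    - Z.c₂ k Δ i / (2 * Z.c₁ k Δ i))

end Solution

end LeaderFollower

end

/-! Put y_i = BᵀP(x_i - x_leader), η_i = BᵀP e_i, W_i = BᵀP w_i. All agents hold the same estimate
of a given state, and the rows of L sum to zero, so W = -L(y - η) and the followers' input is κ W_i.
Integrated along segments (in mean value form), the matrix inequality for the Jacobian makes V = ∑
(x_i - x_leader)ᵀP(x_i - x_leader) satisfy V' ≤ -qV + ρ∑|y_i|² + 2κ∑⟨y_i, W_i⟩.

The gain is split in two. The κ₁ part pays for ρ∑|y_i|², because y vanishes at the leader and L₂₂ ≥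
μI; the κ₂ part leaves -2κ₂ (y - η)ᵀL(y - η) ≤ -2κ₂ε∑|W_i|². What remains are terms in η and ⟨W, η⟩,
which the triggering condition controls: while it is not met, each agent contributes at most ξ
(`coupling_le`, `dissipation`). Hence V' ≤ -qV + Nξ, and V is unchanged by communications, which
gives the asymptotic bound.

Boundedness of w_i is obtained in stages. V bounds y; the untriggered conditions, summed over the
agents, bound η by y (`sum_degree_mul_norm_sq_le`); this bounds the inputs; the contraction of f(·,
θhat) modulo η then bounds the errors themselves (`exists_bounds`). All these estimates are
inductions over the events, so they do not presuppose the absence of Zeno behaviour.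

With w_{i,max} finite, Grönwall gives |e_i| ≤ ν(e^{k(t-b)} - 1) after a communication at time b. At
the next one δ_i ≥ ξ, so ξ ≤ c₁g² + c₂g with g = e^{k(t-b)} - 1; solving the quadratic gives τ_i.
Accumulating events would force one of the finitely many agents to communicate infinitely often in
bounded time. -/

noncomputable section

open scoped NNReal

/-! ### Global flows of Lipschitz vector fields -/

open scoped Manifold in
/-- A continuously differentiable, globally Lipschitz vector field has global integral curves. -/
theorem exists_global_integral_curve {E : Type*} [NormedAddCommGroup E] [NormedSpace ℝ E]
    [CompleteSpace E] {v : E → E} (hv : ContDiff ℝ 1 v) {K : ℝ≥0} (hK : LipschitzWith K v)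
    (t₀ : ℝ) (x₀ : E) : ∃ γ : ℝ → E, γ t₀ = x₀ ∧ ∀ t, HasDerivAt γ (v (γ t)) t := by
  -- On the ball of radius ‖v x‖ + 1 about x the field is bounded by 2(K + 1)(‖v x‖ + 1), and T is
  -- the ratio of the two. It does not depend on x, so local solutions of uniform duration glue to a
  -- global one.
  set T : ℝ := 1 / (2 * (K + 1)) with hT
  have hTpos : 0 < T := by positivity
  have key : ∀ x : E, ∃ γ : ℝ → E, γ 0 = x ∧
      IsMIntegralCurveOn (I := 𝓘(ℝ, E)) γ (v : (x : E) → TangentSpace 𝓘(ℝ, E) x)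
        (Ioo (-T) T) := by
    intro x
    have hx : IsPicardLindelof (fun _ : ℝ => v) (tmin := -T) (tmax := T) ⟨0, by simp [hTpos.le]⟩ x
        (‖v x‖₊ + 1) 0 (2 * (K + 1) * (‖v x‖₊ + 1)) K := by
      refine IsPicardLindelof.of_time_independent ?_ hK.lipschitzOnWith ?_
      · intro y hy
        have h1 : ‖v y‖ ≤ ‖v x‖ + K * ‖y - x‖ := by
          have := hK.dist_le_mul y x
          rw [dist_eq_norm, dist_eq_norm] at this
          have h2 := norm_le_norm_add_norm_sub' (v y) (v x)
          linarith
        have h3 : ‖y - x‖ ≤ ‖v x‖ + 1 := by simpa [dist_eq_norm] using hy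
        have h4 : (K : ℝ) * ‖y - x‖ ≤ K * (‖v x‖ + 1) := by gcongr
        have h5 := mul_nonneg K.coe_nonneg (norm_nonneg (v x))
        have h6 := K.coe_nonneg
        push_cast [coe_nnnorm]
        nlinarith [norm_nonneg (v x)]
      · push_cast [coe_nnnorm]
        simp only [sub_zero, zero_sub, neg_neg, max_self, hT]
        apply le_of_eq
        have h6 : (K : ℝ) + 1 ≠ 0 := by positivity
        field_simp
    obtain ⟨γ, h0, hγ⟩ := hx.exists_eq_forall_mem_Icc_hasDerivWithinAt₀
    refine ⟨γ, h0, ?_⟩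
    intro t ht
    exact ((hγ t (Ioo_subset_Icc_self ht)).mono Ioo_subset_Icc_self).hasFDerivWithinAt.hasMFDerivWithinAt
  obtain ⟨γ, h0, hγ⟩ := exists_isMIntegralCurve_of_isMIntegralCurveOn (I := 𝓘(ℝ, E))
    (v := (v : (x : E) → TangentSpace 𝓘(ℝ, E) x)) (contMDiff_vectorSpace_iff_contDiff.2 hv) hTpos key x₀
  refine ⟨fun t => γ (t - t₀), by simpa using h0, fun t => ?_⟩
  have h1 : HasDerivAt γ (v (γ (t - t₀))) (t - t₀) := by
    exact hasDerivAt_iff_hasFDerivAt.2 (hγ (t - t₀)).hasFDerivAt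
  exact h1.comp_sub_const t t₀

theorem exists_lipschitzWith_pi {ι E : Type*} [Fintype ι] {F : ι → Type*} [PseudoEMetricSpace E]
    [∀ i, PseudoEMetricSpace (F i)] {g : E → ∀ i, F i}
    (h : ∀ i, ∃ K, LipschitzWith K fun x => g x i) : ∃ K, LipschitzWith K g := by
  choose K hK using h
  refine ⟨Finset.univ.sup K, fun x y => edist_pi_le_iff.2 fun i => ?_⟩
  exact (hK i x y).trans (by gcongr; exact Finset.le_sup (f := K) (Finset.mem_univ i))

namespace LeaderFollower

variable {n m p M : ℕ} (S : System n m p M)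

namespace System

theorem contDiff_slice {Ω : Set (Vec p)} (hf : ContDiffOn ℝ 1
      (fun z : Vec n × Vec p => S.f z.1 z.2) (univ ×ˢ Ω)) {θ : Vec p} (hθ : θ ∈ Ω) :
    ContDiff ℝ 1 fun x => S.f x θ := by
  rw [← contDiffOn_univ]
  exact hf.comp (f := fun x : Vec n => (x, θ)) (by fun_prop) (fun x _ => ⟨mem_univ _, hθ⟩)

theorem exists_flow (h₁ : ContDiff ℝ 1 fun x => S.f x S.θ) (h₂ : ContDiff ℝ 1 fun x => S.f x S.θhat)
    {K : ℝ≥0} (hl₁ : LipschitzWith K fun x => S.f x S.θ)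
    (hl₂ : LipschitzWith K fun x => S.f x S.θhat) (t₀ : ℝ) (z₀ : State n M) :
    ∃ z : ℝ → State n M, S.IsFlow z t₀ ∧ z t₀ = z₀ := by
  let X := (Fin (M + 1) → Vec n) × (Fin (M + 1) → Fin (M + 1) → Vec n)
  let st : X → State n M := fun y => ⟨WithLp.toLp 2 y.1, y.2⟩
  let px : Fin (M + 1) → X →L[ℝ] Vec n := fun i =>
    (ContinuousLinearMap.proj i).comp (ContinuousLinearMap.fst ℝ _ _)
  let pe : Fin (M + 1) → Fin (M + 1) → X →L[ℝ] Vec n := fun i j =>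
    (ContinuousLinearMap.proj (R := ℝ) (φ := fun _ : Fin (M + 1) => Vec n) j).comp
      ((ContinuousLinearMap.proj i).comp (ContinuousLinearMap.snd ℝ _ _))
  let ul : Fin (M + 1) → X →L[ℝ] Vec n := fun i =>
    (LinearMap.toContinuousLinearMap (Matrix.toEuclideanLin S.B)).comp
      (if i = 0 then 0 else (-S.κ) • ∑ j, S.L i j • (LinearMap.toContinuousLinearMap
        (Matrix.toEuclideanLin (S.B.transpose * S.P))).comp (pe i j))
  have hu : ∀ i y, ul i y = Matrix.toEuclideanLin S.B (S.control (st y) i) := by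
    intro i y
    by_cases hi : i = 0
    · simp [ul, control, hi]
    · simp only [ul, control, hi, if_false, ContinuousLinearMap.comp_apply,
        smul_apply, sum_apply]
      rfl
  let v : X → X := fun y => (fun i => S.f (y.1 i) S.θ + ul i y, fun i j => S.f (y.2 i j) S.θhat)
  have hv : ContDiff ℝ 1 v := by
    refine ContDiff.prodMk (contDiff_pi.2 fun i => ?_) (contDiff_pi.2 fun i => contDiff_pi.2 fun j => ?_)
    · exact (h₁.comp (g := fun x => S.f x S.θ) (f := fun y : X => y.1 i) (px i).contDiff).add
        (ul i).contDiff
    · exact h₂.comp (g := fun x => S.f x S.θhat) (f := fun y : X => y.2 i j) (pe i j).contDiff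
  obtain ⟨K₁, hK₁⟩ : ∃ K₁, LipschitzWith K₁ fun y : X => fun i => S.f (y.1 i) S.θ + ul i y :=
    exists_lipschitzWith_pi fun i => ⟨_, (hl₁.comp (px i).lipschitz).add (ul i).lipschitz⟩
  obtain ⟨K₂, hK₂⟩ : ∃ K₂, LipschitzWith K₂ fun y : X => fun i j => S.f (y.2 i j) S.θhat :=
    exists_lipschitzWith_pi fun i => exists_lipschitzWith_pi fun j => ⟨_, hl₂.comp (pe i j).lipschitz⟩
  obtain ⟨γ, h0, hγ⟩ := exists_global_integral_curve hv (hK₁.prodMk hK₂) t₀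
    ((WithLp.ofLp z₀.x, z₀.est) : X)
  refine ⟨fun t => st (γ t), ⟨fun t _ i => ?_, fun t _ i j => ?_⟩, ?_⟩
  · have h := (hasDerivAt_pi.1 (hγ t).fst i).hasDerivWithinAt (s := Ici t₀)
    rw [← hu]
    exact h
  · exact (hasDerivAt_pi.1 (hasDerivAt_pi.1 (hγ t).snd i) j).hasDerivWithinAt
  · simp only [h0, st]

/-- Between events, the estimates of one and the same state stay equal if they start equal. -/
theorem IsFlow.est_eq {S : System n m p M} {K : ℝ≥0} (hl : LipschitzWith K fun x => S.f x S.θhat)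
    {z : ℝ → State n M} {t₀ : ℝ} (hz : S.IsFlow z t₀) {i i' j : Fin (M + 1)}
    (h0 : (z t₀).est i j = (z t₀).est i' j) {t : ℝ} (ht : t₀ ≤ t) :
    (z t).est i j = (z t).est i' j := by
  have hc : ∀ i, ContinuousOn (fun s => (z s).est i j) (Icc t₀ t) := fun i s hs =>
    ((hz.2 s hs.1 i j).continuousWithinAt).mono Icc_subset_Ici_self
  have hd : ∀ i, ∀ s ∈ Ico t₀ t, HasDerivWithinAt (fun s => (z s).est i j)
      (S.f ((z s).est i j) S.θhat) (Ici s) s := fun i s hs =>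
    (hz.2 s hs.1 i j).mono (Ici_subset_Ici.2 hs.1)
  exact ODE_solution_unique_of_mem_Icc_right (v := fun _ x => S.f x S.θhat) (s := fun _ => univ)
    (fun _ _ => hl.lipschitzOnWith) (hc i) (hd i) (fun _ _ => mem_univ _) (hc i') (hd i')
    (fun _ _ => mem_univ _) h0 ⟨ht, le_rfl⟩

end System
end LeaderFollower

/-! ### Quadratic forms of the Laplacian and of the metric -/

namespace LeaderFollower

open scoped MatrixOrder

section Forms

variable {ι : Type*} [Fintype ι] {F : Type*} [NormedAddCommGroup F] [InnerProductSpace ℝ F]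

/-- The bilinear form `(A ⊗ I)(y, z)` on families of vectors. -/
def tensorForm (A : Matrix ι ι ℝ) (y z : ι → F) : ℝ := ∑ i, ∑ j, A i j * inner ℝ (y i) (z j)

theorem tensorForm_comm {A : Matrix ι ι ℝ} (hA : A.IsSymm) (y z : ι → F) :
    tensorForm A y z = tensorForm A z y := by
  unfold tensorForm
  rw [Finset.sum_comm]
  refine Finset.sum_congr rfl fun i _ => Finset.sum_congr rfl fun j _ => ?_
  rw [hA.apply, real_inner_comm]

theorem tensorForm_add_left (A : Matrix ι ι ℝ) (y y' z : ι → F) :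
    tensorForm A (y + y') z = tensorForm A y z + tensorForm A y' z := by
  simp only [tensorForm, Pi.add_apply, inner_add_left, mul_add, Finset.sum_add_distrib]

theorem tensorForm_add_right (A : Matrix ι ι ℝ) (y z z' : ι → F) :
    tensorForm A y (z + z') = tensorForm A y z + tensorForm A y z' := by
  simp only [tensorForm, Pi.add_apply, inner_add_right, mul_add, Finset.sum_add_distrib]

theorem tensorForm_smul_left (A : Matrix ι ι ℝ) (c : ℝ) (y z : ι → F) :
    tensorForm A (c • y) z = c * tensorForm A y z := by
  simp only [tensorForm, Pi.smul_apply, real_inner_smul_left, Finset.mul_sum]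
  refine Finset.sum_congr rfl fun i _ => Finset.sum_congr rfl fun j _ => by ring

theorem tensorForm_smul_right (A : Matrix ι ι ℝ) (c : ℝ) (y z : ι → F) :
    tensorForm A y (c • z) = c * tensorForm A y z := by
  simp only [tensorForm, Pi.smul_apply, real_inner_smul_right, Finset.mul_sum]
  refine Finset.sum_congr rfl fun i _ => Finset.sum_congr rfl fun j _ => by ring

theorem tensorForm_eq_sum_inner (A : Matrix ι ι ℝ) (y z : ι → F) :
    tensorForm A y z = ∑ i, inner ℝ (y i) (∑ j, A i j • z j) := by
  simp only [tensorForm, inner_sum, real_inner_smul_right]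

/-- The form of A ⊗ I splits into one copy of the form of A for each coordinate of the vectors. -/
theorem tensorForm_nonneg {A : Matrix ι ι ℝ} (hA : A.PosSemidef) {m : ℕ} (y : ι → Vec m) :
    0 ≤ tensorForm A y y := by
  have h : tensorForm A y y = ∑ c, (fun i => y i c) ⬝ᵥ (A.mulVec fun i => y i c) := by
    simp only [tensorForm, PiLp.inner_apply, dotProduct, Matrix.mulVec, Finset.mul_sum]
    rw [Finset.sum_comm' (t' := Finset.univ) (s' := fun _ => Finset.univ) (by simp)]
    conv_rhs => rw [Finset.sum_comm]
    refine (Finset.sum_comm).trans (Finset.sum_congr rfl fun i _ => ?_)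
    conv_rhs => rw [Finset.sum_comm]
    refine Finset.sum_congr rfl fun j _ => Finset.sum_congr rfl fun c _ => ?_
    simp
    ring
  rw [h]
  exact Finset.sum_nonneg fun c _ => by
    simpa using hA.dotProduct_mulVec_nonneg fun i => y i c

theorem norm_sq_sum_smul_eq_tensorForm [DecidableEq ι] {A : Matrix ι ι ℝ} (hA : A.IsSymm)
    (y : ι → F) : ∑ i, ‖∑ j, A i j • y j‖ ^ 2 = tensorForm (A * A) y y := by
  rw [tensorForm_eq_sum_inner]
  have h : ∀ i, ∑ j, (A * A) i j • y j = ∑ k, A i k • ∑ j, A k j • y j := by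
    intro i
    simp only [Matrix.mul_apply, Finset.sum_smul, Finset.smul_sum, smul_smul]
    rw [Finset.sum_comm]
  simp only [h]
  rw [← tensorForm_eq_sum_inner A y (fun k => ∑ j, A k j • y j), tensorForm_comm hA,
    tensorForm_eq_sum_inner]
  simp only [real_inner_self_eq_norm_sq]

/-- `ε A² ≤ A` for a positive semidefinite matrix with `ε ≤ 1 / λ_max(A)`. -/
theorem posSemidef_sub_smul_mul_self {ι : Type} [Fintype ι] [DecidableEq ι] {A : Matrix ι ι ℝ}
    (hA : A.PosSemidef) {ε : ℝ} (hε₀ : 0 ≤ ε) (hε : ε ≤ 1 / lambdaMax A) :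
    (A - ε • (A * A)).PosSemidef := by
  have hsa : IsSelfAdjoint A := hA.isHermitian.isSelfAdjoint
  have hcfc : cfc (fun x : ℝ => x - ε * (x * x)) A = A - ε • (A * A) := by
    rw [cfc_sub (fun x : ℝ => x) (fun x => ε * (x * x)) A, cfc_const_mul ε (fun x : ℝ => x * x) A,
      cfc_mul (fun x : ℝ => x) (fun x => x) A, cfc_id' ℝ A]
  rw [← Matrix.nonneg_iff_posSemidef, ← hcfc]
  refine cfc_nonneg fun x hx => ?_
  have hx0 : 0 ≤ x := (Matrix.posSemidef_iff_isHermitian_and_spectrum_nonneg.1 hA).2 hx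
  have hx1 : x ≤ lambdaMax A := le_csSup A.finite_real_spectrum.bddAbove hx
  have h2 : ε * x ≤ 1 := by
    -- A positive eigenvalue forces `lambdaMax A` > 0, so the division in the bound on ε is then
    -- genuine.
    rcases hx0.eq_or_lt with rfl | hx0
    · simp
    · calc ε * x ≤ 1 / lambdaMax A * lambdaMax A :=
          mul_le_mul hε hx1 hx0.le (hε₀.trans hε)
        _ = 1 := by rw [one_div, inv_mul_cancel₀ (hx0.trans_le hx1).ne']
  nlinarith

theorem smul_sum_norm_sq_le_tensorForm {ι : Type} [Fintype ι] [DecidableEq ι] {A : Matrix ι ι ℝ}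
    (hA : A.PosSemidef) {ε : ℝ} (hε₀ : 0 ≤ ε) (hε : ε ≤ 1 / lambdaMax A) {m : ℕ} (y : ι → Vec m) :
    ε * ∑ i, ‖∑ j, A i j • y j‖ ^ 2 ≤ tensorForm A y y := by
  have h := tensorForm_nonneg (posSemidef_sub_smul_mul_self hA hε₀ hε) y
  have hs : A.IsSymm := by
    simpa [Matrix.IsHermitian, Matrix.IsSymm] using hA.isHermitian
  rw [norm_sq_sum_smul_eq_tensorForm hs]
  have : tensorForm (A - ε • (A * A)) y y = tensorForm A y y - ε * tensorForm (A * A) y y := by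
    simp only [tensorForm, Matrix.sub_apply, Matrix.smul_apply, smul_eq_mul, sub_mul,
      Finset.sum_sub_distrib, Finset.mul_sum, mul_assoc]
  linarith

/-- Since y vanishes at the leader, only the block of A without the leader's row and column enters.
-/
theorem mul_sum_norm_sq_le_tensorForm {M : ℕ} {A : Matrix (Fin (M + 1)) (Fin (M + 1)) ℝ} {μ : ℝ}
    (hL : (A.submatrix Fin.succ Fin.succ - μ • (1 : Matrix (Fin M) (Fin M) ℝ)).PosSemidef)
    {m : ℕ} {y : Fin (M + 1) → Vec m} (hy : y 0 = 0) :
    μ * ∑ i, ‖y i‖ ^ 2 ≤ tensorForm A y y := by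
  have h := tensorForm_nonneg hL (fun i => y i.succ)
  have h1 : tensorForm (A.submatrix Fin.succ Fin.succ - μ • (1 : Matrix (Fin M) (Fin M) ℝ))
      (fun i => y i.succ) (fun i => y i.succ) = tensorForm A y y - μ * ∑ i, ‖y i‖ ^ 2 := by
    simp only [tensorForm, Fin.sum_univ_succ (n := M), hy, Matrix.sub_apply, Matrix.smul_apply,
      smul_eq_mul, sub_mul, Finset.sum_sub_distrib, Matrix.one_apply]
    simp [Finset.mul_sum]
  linarith

end Forms

section Laplacian

variable {ι : Type} [Fintype ι] [DecidableEq ι] {a : Matrix ι ι ℝ}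

theorem laplacian_isSymm (ha : a.IsSymm) : (laplacian a).IsSymm := by
  ext i j
  by_cases h : i = j
  · subst h; rfl
  · simp [laplacian, h, Ne.symm h, ha.apply]

theorem laplacian_sum_row (hd : ∀ i, a i i = 0) (i : ι) : ∑ j, laplacian a i j = 0 := by
  have : ∀ j, laplacian a i j = (if i = j then ∑ k, a i k else 0) - a i j := by
    intro j
    by_cases h : i = j
    · subst h; simp [laplacian, hd]
    · simp [laplacian, h]
  simp [this]

variable {F : Type*} [NormedAddCommGroup F] [InnerProductSpace ℝ F]

/-- The edge-energy form of the Laplacian; it yields both nonnegativity and the bound by the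
degrees. -/
theorem laplacian_tensorForm (ha : a.IsSymm) (hd : ∀ i, a i i = 0) (y : ι → F) :
    tensorForm (laplacian a) y y = 1 / 2 * ∑ i, ∑ j, a i j * ‖y i - y j‖ ^ 2 := by
  obtain ⟨d, hdiag⟩ : ∃ d : ι → ℝ, ∀ i, laplacian a i i = d i := ⟨_, fun _ => rfl⟩
  have h1 : ∀ i j, laplacian a i j = (if i = j then d i else 0) - a i j := by
    intro i j
    by_cases h : i = j
    · subst h; simp [hd, hdiag]
    · simp [laplacian, h]
  have h2 : ∑ i, ∑ j, a i j * ‖y i‖ ^ 2 = ∑ i, laplacian a i i * ‖y i‖ ^ 2 := by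
    simp [laplacian, Finset.sum_mul]
  have h3 : ∑ i, ∑ j, a i j * ‖y j‖ ^ 2 = ∑ i, laplacian a i i * ‖y i‖ ^ 2 := by
    rw [← h2, Finset.sum_comm]
    simp only [ha.apply]
  have h4 : tensorForm (laplacian a) y y
      = ∑ i, laplacian a i i * ‖y i‖ ^ 2 - ∑ i, ∑ j, a i j * inner ℝ (y i) (y j) := by
    unfold tensorForm
    simp_rw [hdiag, h1, sub_mul, Finset.sum_sub_distrib]
    simp
  rw [h4]
  simp only [norm_sub_sq_real, mul_add, mul_sub, Finset.sum_add_distrib, Finset.sum_sub_distrib,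
    h2, h3]
  have h5 : ∑ i, ∑ j, a i j * (2 * inner ℝ (y i) (y j))
      = 2 * ∑ i, ∑ j, a i j * inner ℝ (y i) (y j) := by
    simp only [Finset.mul_sum]
    exact Finset.sum_congr rfl fun i _ => Finset.sum_congr rfl fun j _ => by ring
  rw [h5]; ring

theorem laplacian_tensorForm_le (ha : a.IsSymm) (hd : ∀ i, a i i = 0) (h0 : ∀ i j, 0 ≤ a i j)
    (y : ι → F) :
    tensorForm (laplacian a) y y ≤ 2 * ∑ i, laplacian a i i * ‖y i‖ ^ 2 := by
  have h2 : ∑ i, ∑ j, a i j * ‖y i‖ ^ 2 = ∑ i, laplacian a i i * ‖y i‖ ^ 2 := by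
    simp [laplacian, Finset.sum_mul]
  have h3 : ∑ i, ∑ j, a i j * ‖y j‖ ^ 2 = ∑ i, laplacian a i i * ‖y i‖ ^ 2 := by
    rw [← h2, Finset.sum_comm]
    simp only [ha.apply]
  rw [laplacian_tensorForm ha hd]
  have h4 : ∑ i, ∑ j, a i j * ‖y i - y j‖ ^ 2
      ≤ ∑ i, ∑ j, (2 * (a i j * ‖y i‖ ^ 2) + 2 * (a i j * ‖y j‖ ^ 2)) := by
    refine Finset.sum_le_sum fun i _ => Finset.sum_le_sum fun j _ => ?_
    have h5 : ‖y i - y j‖ ^ 2 ≤ 2 * ‖y i‖ ^ 2 + 2 * ‖y j‖ ^ 2 := by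
      have := norm_sub_le (y i) (y j)
      nlinarith [sq_nonneg (‖y i‖ - ‖y j‖), norm_nonneg (y i - y j)]
    nlinarith [h0 i j]
  simp only [Finset.sum_add_distrib, ← Finset.mul_sum, h2, h3] at h4
  linarith

theorem laplacian_posSemidef (ha : a.IsSymm) (hd : ∀ i, a i i = 0) (h0 : ∀ i j, 0 ≤ a i j) :
    (laplacian a).PosSemidef := by
  refine Matrix.PosSemidef.of_dotProduct_mulVec_nonneg
    (by simpa [Matrix.IsHermitian, Matrix.IsSymm] using laplacian_isSymm ha) fun x => ?_
  have h : star x ⬝ᵥ (laplacian a).mulVec x = tensorForm (laplacian a) x x := by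
    simp only [tensorForm, dotProduct, Matrix.mulVec, Finset.mul_sum]
    refine Finset.sum_congr rfl fun i _ => Finset.sum_congr rfl fun j _ => ?_
    simp; ring
  rw [h, laplacian_tensorForm ha hd]
  have : 0 ≤ ∑ i, ∑ j, a i j * ‖x i - x j‖ ^ 2 :=
    Finset.sum_nonneg fun i _ => Finset.sum_nonneg fun j _ => mul_nonneg (h0 i j) (by positivity)
  linarith

end Laplacian

section Bilin

variable {n : ℕ}

theorem bilin_eq_inner (A : Matrix (Fin n) (Fin n) ℝ) (v w : Vec n) :
    bilin A v w = inner ℝ v (Matrix.toEuclideanCLM (n := Fin n) (𝕜 := ℝ) A w) :=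
  (Matrix.inner_toEuclideanCLM A v w).symm

theorem abs_bilin_le (A : Matrix (Fin n) (Fin n) ℝ) (v w : Vec n) :
    |bilin A v w| ≤ opNorm A * ‖v‖ * ‖w‖ := by
  rw [bilin_eq_inner]
  calc _ ≤ ‖v‖ * ‖Matrix.toEuclideanCLM (n := Fin n) (𝕜 := ℝ) A w‖ := abs_real_inner_le_norm _ _
    _ ≤ ‖v‖ * (opNorm A * ‖w‖) := by gcongr; exact ContinuousLinearMap.le_opNorm _ _
    _ = _ := by ring

theorem bilin_add_left (A : Matrix (Fin n) (Fin n) ℝ) (u v w : Vec n) :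
    bilin A (u + v) w = bilin A u w + bilin A v w := by
  simp only [bilin_eq_inner, inner_add_left]

theorem bilin_add_right (A : Matrix (Fin n) (Fin n) ℝ) (u v w : Vec n) :
    bilin A u (v + w) = bilin A u v + bilin A u w := by
  simp only [bilin_eq_inner, inner_add_right, map_add]

theorem bilin_smul_left (A : Matrix (Fin n) (Fin n) ℝ) (c : ℝ) (v w : Vec n) :
    bilin A (c • v) w = c * bilin A v w := by
  simp only [bilin_eq_inner, real_inner_smul_left]

theorem bilin_smul_right (A : Matrix (Fin n) (Fin n) ℝ) (c : ℝ) (v w : Vec n) :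
    bilin A v (c • w) = c * bilin A v w := by
  simp only [bilin_eq_inner, real_inner_smul_right, map_smul]

theorem bilin_smul (c : ℝ) (A : Matrix (Fin n) (Fin n) ℝ) (v w : Vec n) :
    bilin (c • A) v w = c * bilin A v w := by
  simp [bilin, Matrix.smul_mulVec]

theorem bilin_sub (A A' : Matrix (Fin n) (Fin n) ℝ) (v w : Vec n) :
    bilin (A - A') v w = bilin A v w - bilin A' v w := by
  simp [bilin, Matrix.sub_mulVec]

theorem bilin_add (A A' : Matrix (Fin n) (Fin n) ℝ) (v w : Vec n) :
    bilin (A + A') v w = bilin A v w + bilin A' v w := by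
  simp [bilin, Matrix.add_mulVec]

theorem bilin_neg (A : Matrix (Fin n) (Fin n) ℝ) (v w : Vec n) :
    bilin (-A) v w = -bilin A v w := by
  simp [bilin, Matrix.neg_mulVec]

theorem bilin_transpose (A : Matrix (Fin n) (Fin n) ℝ) (v w : Vec n) :
    bilin A.transpose v w = bilin A w v := by
  simp only [bilin, Matrix.mulVec_transpose, dotProduct_comm v.ofLp, Matrix.dotProduct_mulVec]

theorem bilin_comm {A : Matrix (Fin n) (Fin n) ℝ} (hA : A.IsSymm) (v w : Vec n) :
    bilin A v w = bilin A w v := by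
  rw [← bilin_transpose, hA.eq]

theorem _root_.Matrix.PosSemidef.bilin_nonneg {A : Matrix (Fin n) (Fin n) ℝ} (hA : A.PosSemidef)
    (v : Vec n) : 0 ≤ bilin A v v := by
  simpa [bilin] using hA.dotProduct_mulVec_nonneg v.ofLp

theorem _root_.Matrix.PosDef.isSymm_real {A : Matrix (Fin n) (Fin n) ℝ} (hA : A.PosDef) :
    A.IsSymm := by
  simpa [Matrix.IsHermitian, Matrix.IsSymm] using hA.isHermitian

/-- Young's inequality in the metric of a positive definite matrix. -/
theorem two_mul_bilin_le {A : Matrix (Fin n) (Fin n) ℝ} (hA : A.PosDef) {c : ℝ} (hc : 0 < c)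
    (v w : Vec n) : 2 * bilin A v w ≤ c * bilin A v v + 1 / c * bilin A w w := by
  -- Expand (cv - w)ᵀA(cv - w) ≥ 0 and divide by c.
  have h := hA.posSemidef.bilin_nonneg (c • v + (-1 : ℝ) • w)
  simp only [bilin_add_left, bilin_add_right, bilin_smul_left, bilin_smul_right,
    bilin_comm hA.isSymm_real w v] at h
  have h2 : c * bilin A v v + 1 / c * bilin A w w - 2 * bilin A v w
      = 1 / c * (c * (c * bilin A v v + -1 * bilin A v w)
        + -1 * (c * bilin A v w + -1 * bilin A w w)) := by
    field_simp; ring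
  have h3 := mul_nonneg (one_div_pos.2 hc).le h
  linarith

theorem lambdaMin_mul_le_bilin {A : Matrix (Fin n) (Fin n) ℝ} (hA : A.PosDef) (v : Vec n) :
    lambdaMin A * ‖v‖ ^ 2 ≤ bilin A v v := by
  have hsa : IsSelfAdjoint A := hA.isHermitian.isSelfAdjoint
  have h : algebraMap ℝ _ (lambdaMin A) ≤ A :=
    (algebraMap_le_iff_le_spectrum (a := A)).2 fun x hx =>
      csInf_le A.finite_real_spectrum.bddBelow hx
  have h2 := (Matrix.le_iff.1 h).bilin_nonneg v
  rw [bilin_sub, Algebra.algebraMap_eq_smul_one, bilin_smul] at h2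
  have h3 : bilin (1 : Matrix (Fin n) (Fin n) ℝ) v v = ‖v‖ ^ 2 := by
    rw [bilin_eq_inner, map_one]
    exact real_inner_self_eq_norm_sq v
  rw [h3] at h2
  linarith

theorem lambdaMin_pos [NeZero n] {A : Matrix (Fin n) (Fin n) ℝ} (hA : A.PosDef) :
    0 < lambdaMin A := by
  have hne : (spectrum ℝ A).Nonempty := by
    rw [hA.isHermitian.spectrum_real_eq_range_eigenvalues]
    exact ⟨_, 0, rfl⟩
  have hmem := hne.csInf_mem A.finite_real_spectrum
  change 0 < sInf (spectrum ℝ A)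
  generalize sInf (spectrum ℝ A) = r at hmem
  rw [hA.isHermitian.spectrum_real_eq_range_eigenvalues] at hmem
  obtain ⟨i, rfl⟩ := hmem
  exact hA.eigenvalues_pos i

/-- Covers n = 0 as well, where the spectrum is empty and `lambdaMin` cannot serve as the constant.
-/
theorem exists_mul_norm_sq_le_bilin {A : Matrix (Fin n) (Fin n) ℝ} (hA : A.PosDef) :
    ∃ c, 0 < c ∧ ∀ v : Vec n, c * ‖v‖ ^ 2 ≤ bilin A v v := by
  rcases Nat.eq_zero_or_pos n with rfl | hn
  · refine ⟨1, one_pos, fun v => ?_⟩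
    have : v = 0 := Subsingleton.elim _ _
    simp [this, bilin]
  · have : NeZero n := ⟨hn.ne'⟩
    exact ⟨_, lambdaMin_pos hA, lambdaMin_mul_le_bilin hA⟩

end Bilin

end LeaderFollower

/-! ### From the Jacobian inequality to incremental contraction -/

namespace LeaderFollower

section Contraction

variable {n : ℕ}

theorem jacobian_mulVec (g : Vec n → Vec n) (x v : Vec n) :
    (jacobian g x).mulVec v.ofLp = (fderiv ℝ g x v).ofLp := by
  have hv : v = ∑ j, v j • EuclideanSpace.single j (1 : ℝ) := by
    have := (EuclideanSpace.basisFun (Fin n) ℝ).sum_repr v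
    simpa using this.symm
  ext i
  conv_rhs => rw [hv, map_sum]
  simp only [Matrix.mulVec, dotProduct, jacobian, Matrix.of_apply, map_smul, WithLp.ofLp_sum,
    WithLp.ofLp_smul, Finset.sum_apply, Pi.smul_apply, smul_eq_mul]
  exact Finset.sum_congr rfl fun j _ => mul_comm _ _

theorem bilin_mul_jacobian (A : Matrix (Fin n) (Fin n) ℝ) (g : Vec n → Vec n) (x v w : Vec n) :
    bilin (A * jacobian g x) v w = bilin A v (fderiv ℝ g x w) := by
  simp only [bilin, ← Matrix.mulVec_mulVec, jacobian_mulVec]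

/-- A matrix inequality for the Jacobian yields the corresponding incremental inequality. -/
theorem incremental_of_jacobian {P Q : Matrix (Fin n) (Fin n) ℝ} (hP : P.IsSymm)
    {g : Vec n → Vec n} (hg : Differentiable ℝ g) {q ρ : ℝ}
    (h : ∀ x, (-(q • P) - ((jacobian g x).transpose * P + P * jacobian g x - ρ • Q)).PosSemidef)
    (x y : Vec n) :
    2 * bilin P (x - y) (g x - g y) ≤ ρ * bilin Q (x - y) (x - y) - q * bilin P (x - y) (x - y) := by
  set v := x - y with hv
  have hd : ∀ s : ℝ, HasDerivAt (fun s : ℝ => bilin P v (g (y + s • v)))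
      (bilin P v (fderiv ℝ g (y + s • v) v)) s := by
    intro s
    simp only [bilin_eq_inner]
    have h1 : HasDerivAt (fun s : ℝ => y + s • v) v s := by
      simpa using ((hasDerivAt_id s).smul_const v).const_add y
    have h2 := (hg (y + s • v)).hasFDerivAt.comp_hasDerivAt s h1
    have h3 := (Matrix.toEuclideanCLM (n := Fin n) (𝕜 := ℝ) P).hasFDerivAt.comp_hasDerivAt s h2
    simpa using (hasDerivAt_const s v).inner ℝ h3
  -- The mean value theorem for the scalar function s ↦ vᵀP g(y + sv): the increment is a derivative
  -- at one point of the segment, where the matrix inequality is applied to v.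
  obtain ⟨s, -, hs⟩ := exists_hasDerivAt_eq_slope (fun s : ℝ => bilin P v (g (y + s • v))) _
    zero_lt_one (fun s _ => (hd s).continuousAt.continuousWithinAt) (fun s _ => hd s)
  have h4 : y + v = x := by simp [hv]
  simp only [one_smul, zero_smul, add_zero, sub_zero, div_one, h4] at hs
  have h5 := (h (y + s • v)).bilin_nonneg v
  have h6 : (jacobian g (y + s • v)).transpose * P = (P * jacobian g (y + s • v)).transpose := by
    rw [Matrix.transpose_mul, hP.eq]
  rw [h6] at h5
  simp only [bilin_sub, bilin_neg, bilin_add, bilin_smul, bilin_transpose, bilin_mul_jacobian] at h5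
  have h7 : bilin P v (g x - g y) = bilin P v (g x) - bilin P v (g y) := by
    simp only [bilin_eq_inner, map_sub, inner_sub_right]
  rw [h7]
  linarith

end Contraction

/-! ### Standing conditions and the algebra of the coupling -/

variable {n m p M : ℕ}

/-- The standing conditions on the closed loop, in the form in which they are used. -/
structure Admissible (S : System n m p M) (μ q ρ k Δ : ℝ) : Prop where
  symm : S.a.IsSymm
  loopless : ∀ i, S.a i i = 0
  weight_nonneg : ∀ i j, 0 ≤ S.a i j
  degree_pos : ∀ i, 0 < S.L i i
  grounded : (S.L.submatrix Fin.succ Fin.succ - μ • (1 : Matrix (Fin M) (Fin M) ℝ)).PosSemidef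
  posDef : S.P.PosDef
  μ_pos : 0 < μ
  q_pos : 0 < q
  ρ_pos : 0 < ρ
  k_pos : 0 < k
  Δ_nonneg : 0 ≤ Δ
  smooth : ContDiff ℝ 1 fun x => S.f x S.θ
  smooth_hat : ContDiff ℝ 1 fun x => S.f x S.θhat
  incremental : ∀ x y, 2 * bilin S.P (x - y) (S.f x S.θ - S.f y S.θ)
    ≤ ρ * bilin S.Q (x - y) (x - y) - q * bilin S.P (x - y) (x - y)
  incremental_hat : ∀ x y, 2 * bilin S.P (x - y) (S.f x S.θhat - S.f y S.θhat)
    ≤ ρ * bilin S.Q (x - y) (x - y) - q * bilin S.P (x - y) (x - y)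
  lip : ∀ x y, ‖S.f x S.θ - S.f y S.θ‖ ≤ k * ‖x - y‖
  lip_hat : ∀ x y, ‖S.f x S.θhat - S.f y S.θhat‖ ≤ k * ‖x - y‖
  mismatch : ∀ x, ‖S.f x S.θhat - S.f x S.θ‖ ≤ Δ
  κ₁_gt : ρ / (2 * μ) < S.κ₁
  κ₂_pos : 0 < S.κ₂
  ε_nonneg : 0 ≤ S.ε
  ε_le : S.ε ≤ 1 / lambdaMax S.L
  b_pos : ∀ i, 0 < S.b i
  b_lt : ∀ i, S.b i < 1 / (2 * S.L i i)
  σ_pos : ∀ i, 0 < S.σ i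
  σ_lt : ∀ i, S.σ i < 1
  ξ_pos : 0 < S.ξ

namespace System

variable (S : System n m p M)

/-- The linear map `x ↦ Bᵀ P x`. -/
def αLin : Vec n →ₗ[ℝ] Vec m := Matrix.toEuclideanLin (S.B.transpose * S.P)

/-- The coefficient of `P B Bᵀ P` in `Sᵢ`. -/
def sCoeff (i : Fin (M + 1)) : ℝ :=
  2 * S.κ * S.L i i * S.b i + 2 * S.κ * S.L i i / S.b i
    + S.κ₂ * S.ε * (4 * S.L i i / S.b i
      + ((M : ℝ) + 1) * (∑ j, S.L i j ^ 2) * (S.b i / 2 + 1 / (2 * S.b i)))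

/-- The coefficient of `P B Bᵀ P` in `Θᵢ`. -/
def θCoeff (i : Fin (M + 1)) : ℝ := 2 * S.κ₂ * S.ε * (1 - 2 * S.L i i * S.b i)

variable {S}

theorem bilin_P_B (hP : S.P.IsSymm) (v : Vec n) (u : Vec m) :
    bilin S.P v (Matrix.toEuclideanLin S.B u) = inner ℝ (S.αLin v) u := by
  simp only [bilin, αLin, EuclideanSpace.inner_eq_star_dotProduct, Matrix.ofLp_toLpLin,
    Matrix.toLin'_apply, star_trivial]
  rw [← Matrix.transpose_transpose (S.B.transpose * S.P), Matrix.mulVec_transpose,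
    dotProduct_comm u.ofLp, ← Matrix.dotProduct_mulVec, Matrix.transpose_mul,
    Matrix.transpose_transpose, hP.eq, ← Matrix.mulVec_mulVec]

theorem bilin_Q (hP : S.P.IsSymm) (v w : Vec n) :
    bilin S.Q v w = inner ℝ (S.αLin v) (S.αLin w) := by
  rw [← bilin_P_B hP]
  simp only [bilin, Q, αLin, Matrix.ofLp_toLpLin, Matrix.toLin'_apply, Matrix.mulVec_mulVec,
    Matrix.mul_assoc]

theorem sum_L {μ q ρ k Δ : ℝ} (h : Admissible S μ q ρ k Δ) (i : Fin (M + 1)) : ∑ j, S.L i j = 0 :=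
  laplacian_sum_row h.loopless i

theorem w_eq_neg {μ q ρ k Δ : ℝ} (h : Admissible S μ q ρ k Δ) (z : State n M) (i : Fin (M + 1)) :
    S.w z i = -∑ j, S.L i j • z.est i j := by
  simp only [w, smul_sub, Finset.sum_sub_distrib, ← Finset.sum_smul, sum_L h, zero_smul, zero_sub]

/-- Zero row sums allow agent i's own estimate to be subtracted in the control law, so the input is
governed by the same w_i that the triggering condition monitors. -/
theorem control_eq {μ q ρ k Δ : ℝ} (h : Admissible S μ q ρ k Δ) (z : State n M)
    {i : Fin (M + 1)} (hi : i ≠ 0) : S.control z i = S.κ • S.αLin (S.w z i) := by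
  simp only [control, hi, if_false, w_eq_neg h, map_neg, map_sum, map_smul, smul_neg, neg_smul]
  rfl

end System

open LeaderFollower.System

namespace Admissible

variable {S : System n m p M} {μ q ρ k Δ : ℝ} (h : Admissible S μ q ρ k Δ)
include h

theorem κ₁_pos : 0 < S.κ₁ := lt_trans (div_pos h.ρ_pos (mul_pos two_pos h.μ_pos)) h.κ₁_gt

theorem κ_pos : 0 < S.κ := add_pos h.κ₁_pos h.κ₂_pos

theorem isSymm_P : S.P.IsSymm := h.posDef.isSymm_real

theorem isSymm_L : S.L.IsSymm := laplacian_isSymm h.symm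

/-- Comes from b + 1/b ≥ 2, the remaining terms being nonnegative. The dissipation estimates use no
other property of this coefficient. -/
theorem four_mul_le_sCoeff (i : Fin (M + 1)) : 4 * S.κ * S.L i i ≤ S.sCoeff i := by
  have hb := h.b_pos i
  have hl := h.degree_pos i
  have hκ := h.κ_pos
  have hκ₂ := h.κ₂_pos
  have hε := h.ε_nonneg
  have h1 : 2 ≤ S.b i + 1 / S.b i := by
    have : S.b i + 1 / S.b i - 2 = (S.b i - 1) ^ 2 / S.b i := by field_simp; ring
    have h2 : 0 ≤ (S.b i - 1) ^ 2 / S.b i := by positivity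
    linarith
  have h3 : 0 ≤ S.κ₂ * S.ε * (4 * S.L i i / S.b i
      + ((M : ℝ) + 1) * (∑ j, S.L i j ^ 2) * (S.b i / 2 + 1 / (2 * S.b i))) := by positivity
  have h4 : 2 * S.κ * S.L i i * S.b i + 2 * S.κ * S.L i i / S.b i
      = 2 * S.κ * S.L i i * (S.b i + 1 / S.b i) := by ring
  have h5 : 2 * S.κ * S.L i i * 2 ≤ 2 * S.κ * S.L i i * (S.b i + 1 / S.b i) := by gcongr
  unfold sCoeff
  linarith

theorem sCoeff_pos (i : Fin (M + 1)) : 0 < S.sCoeff i :=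
  lt_of_lt_of_le (mul_pos (mul_pos four_pos h.κ_pos) (h.degree_pos i)) (h.four_mul_le_sCoeff i)

theorem θCoeff_nonneg (i : Fin (M + 1)) : 0 ≤ S.θCoeff i := by
  have hl := h.degree_pos i
  have h1 := h.b_lt i
  rw [lt_div_iff₀ (by positivity)] at h1
  have hκ₂ := h.κ₂_pos
  have hε := h.ε_nonneg
  exact mul_nonneg (by positivity) (by linarith)

theorem θCoeff_le (i : Fin (M + 1)) : S.θCoeff i ≤ 2 * S.κ₂ * S.ε := by
  have hl := h.degree_pos i
  have hκ₂ := h.κ₂_pos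
  have hε := h.ε_nonneg
  have hb := h.b_pos i
  have : 0 ≤ 2 * S.κ₂ * S.ε * (2 * S.L i i * S.b i) := by positivity
  unfold θCoeff
  linarith

theorem trigger_eq (z : State n M) (i : Fin (M + 1)) :
    S.trigger z i = S.sCoeff i * ‖S.αLin (err z i)‖ ^ 2
      + 2 * S.κ * |inner ℝ (S.αLin (S.w z i)) (S.αLin (err z i))|
      - S.σ i * (S.θCoeff i * ‖S.αLin (S.w z i)‖ ^ 2) - S.ξ := by
  unfold trigger δ Smat R Θ
  rw [bilin_smul, bilin_smul, bilin_smul, bilin_Q h.isSymm_P, bilin_Q h.isSymm_P,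
    bilin_Q h.isSymm_P, abs_mul, abs_of_pos (mul_pos two_pos h.κ_pos), real_inner_self_eq_norm_sq,
    real_inner_self_eq_norm_sq]
  rfl

/-- The decrease that the coupling forces on the disagreement of the followers and the leader. -/
theorem coupling_le {y η W : Fin (M + 1) → Vec m} (hy : y 0 = 0)
    (hW : ∀ i, W i = -∑ j, S.L i j • (y j - η j)) :
    ρ * ∑ i, ‖y i‖ ^ 2 + 2 * S.κ * ∑ i, inner ℝ (y i) (W i)
      ≤ ∑ i, (S.sCoeff i * ‖η i‖ ^ 2 + 2 * S.κ * |inner ℝ (W i) (η i)|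
        - S.θCoeff i * ‖W i‖ ^ 2) := by
  -- With v = y - η, expanding 2κ₁ yᵀLy - 2κ yᵀLv leaves -2κ₂ vᵀLv + 2(κ₁ - κ₂) ηᵀLv + 2κ₁ ηᵀLη; the
  -- three terms are absorbed by Θ, R and S respectively.
  obtain ⟨v, rfl⟩ : ∃ v, y = v + η := ⟨y - η, by simp⟩
  have hW' : ∀ i, W i = -∑ j, S.L i j • v j := fun i => by simpa using hW i
  have hκ := h.κ_pos
  have hμ := h.μ_pos
  have hκ₁ := h.κ₁_pos
  have hκ₂ := h.κ₂_pos
  have h1 := mul_sum_norm_sq_le_tensorForm h.grounded hy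
  have h2 : ρ * ∑ i, ‖(v + η) i‖ ^ 2 ≤ 2 * S.κ₁ * tensorForm S.L (v + η) (v + η) := by
    have h3 := h.κ₁_gt
    rw [div_lt_iff₀ (by positivity)] at h3
    have h4 : 0 ≤ ∑ i, ‖(v + η) i‖ ^ 2 := by positivity
    nlinarith
  have h3 : ∑ i, inner ℝ ((v + η) i) (W i) = -tensorForm S.L (v + η) v := by
    simp only [tensorForm_eq_sum_inner, hW', inner_neg_right, Finset.sum_neg_distrib]
  have h4 : ∑ i, inner ℝ (W i) (η i) = -tensorForm S.L η v := by
    simp only [tensorForm_eq_sum_inner, hW', inner_neg_left, Finset.sum_neg_distrib, real_inner_comm]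
  have h5 : S.ε * ∑ i, ‖W i‖ ^ 2 ≤ tensorForm S.L v v := by
    simp only [hW', norm_neg]
    exact smul_sum_norm_sq_le_tensorForm
      (laplacian_posSemidef h.symm h.loopless h.weight_nonneg) h.ε_nonneg h.ε_le v
  have h6 : tensorForm S.L η η ≤ 2 * ∑ i, S.L i i * ‖η i‖ ^ 2 :=
    laplacian_tensorForm_le h.symm h.loopless h.weight_nonneg η
  have h7 : 2 * S.κ₁ * tensorForm S.L η η ≤ ∑ i, S.sCoeff i * ‖η i‖ ^ 2 := by
    calc 2 * S.κ₁ * tensorForm S.L η η ≤ 2 * S.κ * tensorForm S.L η η := by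
          have : 0 ≤ tensorForm S.L η η :=
            tensorForm_nonneg (laplacian_posSemidef h.symm h.loopless h.weight_nonneg) η
          have h' : S.κ₁ ≤ S.κ := by unfold System.κ; linarith
          gcongr
      _ ≤ 2 * S.κ * (2 * ∑ i, S.L i i * ‖η i‖ ^ 2) := by gcongr
      _ = ∑ i, 4 * S.κ * S.L i i * ‖η i‖ ^ 2 := by
          simp only [Finset.mul_sum]
          exact Finset.sum_congr rfl fun i _ => by ring
      _ ≤ _ := Finset.sum_le_sum fun i _ => by gcongr; exact h.four_mul_le_sCoeff i
  have h8 : ∑ i, S.θCoeff i * ‖W i‖ ^ 2 ≤ 2 * S.κ₂ * (S.ε * ∑ i, ‖W i‖ ^ 2) := by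
    rw [← mul_assoc, Finset.mul_sum]
    exact Finset.sum_le_sum fun i _ => by gcongr; exact h.θCoeff_le i
  -- The cross term has no definite sign, but |κ₂ - κ₁| ≤ κ₁ + κ₂ = κ.
  have h9 : 2 * (S.κ₂ - S.κ₁) * ∑ i, inner ℝ (W i) (η i)
      ≤ 2 * S.κ * ∑ i, |inner ℝ (W i) (η i)| := by
    have ha : |∑ i, inner ℝ (W i) (η i)| ≤ ∑ i, |inner ℝ (W i) (η i)| :=
      Finset.abs_sum_le_sum_abs _ _
    have hb : |2 * (S.κ₂ - S.κ₁)| ≤ 2 * S.κ := by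
      unfold System.κ
      rw [abs_le]; constructor <;> linarith
    calc _ ≤ |2 * (S.κ₂ - S.κ₁) * ∑ i, inner ℝ (W i) (η i)| := le_abs_self _
      _ = |2 * (S.κ₂ - S.κ₁)| * |∑ i, inner ℝ (W i) (η i)| := abs_mul _ _
      _ ≤ _ := by gcongr
  have h10 : tensorForm S.L v η = tensorForm S.L η v := tensorForm_comm h.isSymm_L _ _
  simp only [Finset.sum_sub_distrib, Finset.sum_add_distrib, ← Finset.mul_sum]
  rw [h3]
  simp only [tensorForm_add_left, tensorForm_add_right, h10] at h2 ⊢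
  have h11 : 2 * S.κ₂ * (S.ε * ∑ i, ‖W i‖ ^ 2) ≤ 2 * S.κ₂ * tensorForm S.L v v := by gcongr
  have h12 : S.κ = S.κ₁ + S.κ₂ := rfl
  rw [h4] at h9
  rw [h12] at h9 ⊢
  linarith

/-- An absorption argument: W = -L(y - η) involves η itself, but its η-part costs less than the 4κ ∑
l_ii|η_i|² available on the left. -/
theorem sum_degree_mul_norm_sq_le {y η W : Fin (M + 1) → Vec m}
    (hW : ∀ i, W i = -∑ j, S.L i j • (y j - η j)) {C : ℝ}
    (hC : ∑ i, S.sCoeff i * ‖η i‖ ^ 2 ≤ ∑ i, S.θCoeff i * ‖W i‖ ^ 2 + C) :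
    2 * S.κ₁ * ∑ i, S.L i i * ‖η i‖ ^ 2
      ≤ 4 * S.κ₂ * (1 + 2 * S.κ₂ / S.κ₁) * ∑ i, S.L i i * ‖y i‖ ^ 2 + C := by
  have hκ := h.κ_pos
  have hκ₁ := h.κ₁_pos
  have hκ₂ := h.κ₂_pos
  have hpsd : S.L.PosSemidef := laplacian_posSemidef h.symm h.loopless h.weight_nonneg
  have h5 : S.ε * ∑ i, ‖W i‖ ^ 2 ≤ tensorForm S.L (y - η) (y - η) := by
    simp only [hW, norm_neg]
    exact smul_sum_norm_sq_le_tensorForm hpsd h.ε_nonneg h.ε_le (y - η)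
  have h8 : ∑ i, S.θCoeff i * ‖W i‖ ^ 2 ≤ 2 * S.κ₂ * (S.ε * ∑ i, ‖W i‖ ^ 2) := by
    rw [← mul_assoc, Finset.mul_sum]
    exact Finset.sum_le_sum fun i _ => by gcongr; exact h.θCoeff_le i
  have h6 : tensorForm S.L η η ≤ 2 * ∑ i, S.L i i * ‖η i‖ ^ 2 :=
    laplacian_tensorForm_le h.symm h.loopless h.weight_nonneg η
  have h6' : tensorForm S.L y y ≤ 2 * ∑ i, S.L i i * ‖y i‖ ^ 2 :=
    laplacian_tensorForm_le h.symm h.loopless h.weight_nonneg y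
  have h7 : 4 * S.κ * ∑ i, S.L i i * ‖η i‖ ^ 2 ≤ ∑ i, S.sCoeff i * ‖η i‖ ^ 2 := by
    rw [Finset.mul_sum]
    refine Finset.sum_le_sum fun i _ => ?_
    rw [← mul_assoc]
    gcongr; exact h.four_mul_le_sCoeff i
  have h10 : tensorForm S.L y η = tensorForm S.L η y := tensorForm_comm h.isSymm_L _ _
  -- Young's parameter: the η-part of the right side becomes (4κ₂ + 4κ₂c) ∑ l_ii|η_i|² with 4κ₂c =
  -- 2κ₁, so 2κ₁ of the total 4(κ₁ + κ₂) survives on the left.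
  set c := S.κ₁ / (2 * S.κ₂) with hc
  have hcpos : 0 < c := by positivity
  have h9 : tensorForm S.L (y - η) (y - η)
      ≤ (1 + 1 / c) * tensorForm S.L y y + (1 + c) * tensorForm S.L η η := by
    have h1 := tensorForm_nonneg hpsd (y + c • η)
    have h2 : y - η = y + (-1 : ℝ) • η := by simp [sub_eq_add_neg]
    rw [h2]
    simp only [tensorForm_add_left, tensorForm_add_right, tensorForm_smul_left,
      tensorForm_smul_right] at h1 ⊢
    rw [h10] at h1 ⊢
    have h3 := mul_nonneg (one_div_pos.2 hcpos).le h1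
    have h4 : 1 / c * (tensorForm S.L y y + c * tensorForm S.L η y
      + c * (tensorForm S.L η y + c * tensorForm S.L η η))
      = 1 / c * tensorForm S.L y y + 2 * tensorForm S.L η y + c * tensorForm S.L η η := by
      field_simp; ring
    linarith
  have h11 : S.κ₂ * c = S.κ₁ / 2 := by rw [hc]; field_simp
  have h12 : 1 / c = 2 * S.κ₂ / S.κ₁ := by rw [hc]; field_simp
  rw [← h12]
  have h13 : 2 * S.κ₂ * tensorForm S.L (y - η) (y - η)
      ≤ 2 * S.κ₂ * ((1 + 1 / c) * (2 * ∑ i, S.L i i * ‖y i‖ ^ 2)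
        + (1 + c) * (2 * ∑ i, S.L i i * ‖η i‖ ^ 2)) := by
    refine mul_le_mul_of_nonneg_left (h9.trans ?_) (by positivity)
    gcongr
  have h14 : 2 * S.κ₂ * (S.ε * ∑ i, ‖W i‖ ^ 2) ≤ 2 * S.κ₂ * tensorForm S.L (y - η) (y - η) := by
    gcongr
  have h15 : S.κ = S.κ₁ + S.κ₂ := rfl
  rw [h15] at h7
  have h16 : 2 * S.κ₂ * ((1 + 1 / c) * (2 * ∑ i, S.L i i * ‖y i‖ ^ 2)
        + (1 + c) * (2 * ∑ i, S.L i i * ‖η i‖ ^ 2))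
      = 4 * S.κ₂ * (1 + 1 / c) * ∑ i, S.L i i * ‖y i‖ ^ 2
        + (4 * S.κ₂ + 4 * (S.κ₂ * c)) * ∑ i, S.L i i * ‖η i‖ ^ 2 := by ring
  rw [h16, h11] at h13
  linarith

end Admissible

end LeaderFollower

/-! ### Dissipation between events -/

namespace LeaderFollower

open LeaderFollower.System

section Decay

/-- Exponential decay up to `C / q` of a function with `g' ≤ -q g + C`. -/
theorem exp_mul_sub_le_of_hasDerivWithinAt {g g' : ℝ → ℝ} {a b q C : ℝ} (hq : 0 < q)
    (hc : ContinuousOn g (Icc a b)) (hd : ∀ t ∈ Ioo a b, HasDerivWithinAt g (g' t) (Ici a) t)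
    (hle : ∀ t ∈ Ioo a b, g' t ≤ -q * g t + C) {t : ℝ} (ht : t ∈ Icc a b) :
    Real.exp (q * t) * (g t - C / q) ≤ Real.exp (q * a) * (g a - C / q) := by
  have hd' : ∀ s ∈ interior (Icc a b), HasDerivWithinAt
      (fun s => Real.exp (q * s) * (g s - C / q))
      (Real.exp (q * s) * q * (g s - C / q) + Real.exp (q * s) * g' s) (interior (Icc a b)) s := by
    intro s hs
    rw [interior_Icc] at hs ⊢
    have h1 : HasDerivAt (fun s => Real.exp (q * s)) (Real.exp (q * s) * q) s := by
      simpa using ((hasDerivAt_id s).const_mul q).exp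
    exact h1.hasDerivWithinAt.mul
      (((hd s hs).mono (Ioo_subset_Icc_self.trans Icc_subset_Ici_self)).sub_const _)
  have hanti : AntitoneOn (fun s => Real.exp (q * s) * (g s - C / q)) (Icc a b) := by
    refine antitoneOn_of_hasDerivWithinAt_nonpos (convex_Icc a b) ?_ hd' ?_
    · exact (by fun_prop : Continuous fun s => Real.exp (q * s)).continuousOn.mul
        (hc.sub continuousOn_const)
    · intro s hs
      rw [interior_Icc] at hs
      have h1 := hle s hs
      have h2 : q * (C / q) = C := by field_simp
      have h3 : q * (g s - C / q) + g' s ≤ 0 := by rw [mul_sub, h2]; linarith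
      nlinarith [Real.exp_pos (q * s)]
  exact hanti ⟨le_rfl, ht.1.trans ht.2⟩ ht ht.1

end Decay

variable {n m p M : ℕ}

theorem hasDerivWithinAt_bilin_self {A : Matrix (Fin n) (Fin n) ℝ} (hA : A.IsSymm)
    {v : ℝ → Vec n} {v' : Vec n} {s : Set ℝ} {t : ℝ} (hv : HasDerivWithinAt v v' s t) :
    HasDerivWithinAt (fun t => bilin A (v t) (v t)) (2 * bilin A (v t) v') s t := by
  have h1 := (Matrix.toEuclideanCLM (n := Fin n) (𝕜 := ℝ) A).hasFDerivAt.comp_hasDerivWithinAt t hv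
  have h2 := hv.inner ℝ h1
  have h3 : 2 * bilin A (v t) v' = bilin A (v t) v' + bilin A v' (v t) := by
    rw [bilin_comm hA v' (v t)]; ring
  rw [h3]
  simp only [bilin_eq_inner]
  exact h2

/-- All agents hold the same estimate of each state. -/
def State.Consistent (z : State n M) : Prop := ∀ i j, z.est i j = z.est j j

/-- The deviation from the leader. -/
def State.dev (z : State n M) (i : Fin (M + 1)) : Vec n := z.x i - z.x 0

namespace System

variable (S : System n m p M)

theorem control_zero (z : State n M) : S.control z 0 = 0 := if_pos rfl

/-- The velocity of agent `i`. -/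
def vel (z : State n M) (i : Fin (M + 1)) : Vec n :=
  S.f (z.x i) S.θ + Matrix.toEuclideanLin S.B (S.control z i)

/-- The Lyapunov function `∑ᵢ (xᵢ - x₁)ᵀ P (xᵢ - x₁)`. -/
def lyap (z : State n M) : ℝ := ∑ i, bilin S.P (z.dev i) (z.dev i)

/-- The energy `eᵢᵀ P eᵢ` of an error. -/
def errEnergy (z : State n M) (i : Fin (M + 1)) : ℝ := bilin S.P (err z i) (err z i)

/-- The perturbation in the dynamics of the error of agent `i`. -/
def errInput (z : State n M) (i : Fin (M + 1)) : Vec n :=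
  (S.f (z.x i) S.θ - S.f (z.x i) S.θhat) + Matrix.toEuclideanLin S.B (S.control z i)

end System

theorem dev_zero (z : State n M) : z.dev 0 = 0 := sub_self _

namespace Admissible

variable {S : System n m p M} {μ q ρ k Δ : ℝ} (h : Admissible S μ q ρ k Δ)
include h

/-- Consistency turns every estimate of x_j into x_j - e_j, and subtracting the leader's state
throughout is free because the rows of L sum to zero. -/
theorem w_eq {z : State n M} (hz : z.Consistent) (i : Fin (M + 1)) :
    S.w z i = -∑ j, S.L i j • (z.dev j - err z j) := by
  rw [w_eq_neg h]
  congr 1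
  have h1 : ∀ j, S.L i j • (z.dev j - err z j) = S.L i j • z.est i j - S.L i j • z.x 0 := by
    intro j
    rw [← smul_sub, hz i j]
    congr 1
    simp only [State.dev, err]
    abel
  simp only [h1, Finset.sum_sub_distrib, ← Finset.sum_smul, sum_L h, zero_smul, sub_zero]

theorem map_w {F : Type*} [NormedAddCommGroup F] [NormedSpace ℝ F] (A : Vec n →ₗ[ℝ] F)
    {z : State n M} (hz : z.Consistent) (i : Fin (M + 1)) :
    A (S.w z i) = -∑ j, S.L i j • (A (z.dev j) - A (err z j)) := by
  simp only [h.w_eq hz, map_neg, map_sum, map_smul, map_sub]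

/-- Needed for A = BᵀP, to bound the inputs before the errors are known to be bounded, and later for
A = id, to bound w itself. -/
theorem norm_map_w_le {F : Type*} [NormedAddCommGroup F] [NormedSpace ℝ F] (A : Vec n →ₗ[ℝ] F)
    {z : State n M} (hz : z.Consistent) {X E : ℝ} (hX : ∀ j, ‖A (z.dev j)‖ ≤ X)
    (hE : ∀ j, ‖A (err z j)‖ ≤ E) (i : Fin (M + 1)) :
    ‖A (S.w z i)‖ ≤ (∑ j, |S.L i j|) * (X + E) := by
  rw [h.map_w A hz, norm_neg, Finset.sum_mul]
  refine (norm_sum_le _ _).trans (Finset.sum_le_sum fun j _ => ?_)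
  rw [norm_smul, Real.norm_eq_abs]
  gcongr
  exact (norm_sub_le _ _).trans (add_le_add (hX j) (hE j))

/-- Dissipation inequality while no triggering condition is met. -/
theorem dissipation {z : State n M} (hz : z.Consistent) (ht : ∀ i, S.trigger z i ≤ 0) :
    ∑ i, 2 * bilin S.P (z.dev i) (S.vel z i - S.vel z 0)
      ≤ -q * S.lyap z + ((M : ℝ) + 1) * S.ξ := by
  have h1 : ∀ i, 2 * bilin S.P (z.dev i) (S.vel z i - S.vel z 0)
      ≤ ρ * ‖S.αLin (z.dev i)‖ ^ 2 - q * bilin S.P (z.dev i) (z.dev i)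
        + 2 * S.κ * inner ℝ (S.αLin (z.dev i)) (S.αLin (S.w z i)) := by
    intro i
    by_cases hi : i = 0
    · subst hi
      simp [dev_zero, bilin]
    · have h2 : S.vel z i - S.vel z 0 = (S.f (z.x i) S.θ - S.f (z.x 0) S.θ)
          + Matrix.toEuclideanLin S.B (S.control z i) := by
        simp only [vel, control_zero, map_zero, add_zero]
        abel
      have h3 := h.incremental (z.x i) (z.x 0)
      rw [bilin_Q h.isSymm_P, real_inner_self_eq_norm_sq] at h3
      rw [h2, bilin_add_right, bilin_P_B h.isSymm_P, control_eq h z hi, inner_smul_right]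
      change 2 * bilin S.P (z.dev i) _ ≤ ρ * ‖S.αLin (z.dev i)‖ ^ 2
        - q * bilin S.P (z.dev i) (z.dev i) at h3
      linarith
  have h2 := h.coupling_le (y := fun i => S.αLin (z.dev i)) (η := fun i => S.αLin (err z i))
    (W := fun i => S.αLin (S.w z i)) (by simp [dev_zero]) (h.map_w S.αLin hz)
  -- The untriggered condition has σ_i Θ_i in place of Θ_i, and σ_i < 1.
  have h3 : ∀ i, S.sCoeff i * ‖S.αLin (err z i)‖ ^ 2
      + 2 * S.κ * |inner ℝ (S.αLin (S.w z i)) (S.αLin (err z i))|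
        - S.θCoeff i * ‖S.αLin (S.w z i)‖ ^ 2 ≤ S.ξ := by
    intro i
    have h4 := ht i
    rw [h.trigger_eq] at h4
    have h5 : 0 ≤ S.θCoeff i * ‖S.αLin (S.w z i)‖ ^ 2 :=
      mul_nonneg (h.θCoeff_nonneg i) (by positivity)
    nlinarith [h.σ_lt i]
  have h4 := Finset.sum_le_sum fun i (_ : i ∈ Finset.univ) => h1 i
  have h5 := Finset.sum_le_sum fun i (_ : i ∈ Finset.univ) => h3 i
  simp only [Finset.sum_const, Finset.card_univ, Fintype.card_fin, nsmul_eq_mul, Nat.cast_add,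
    Nat.cast_one] at h5
  rw [Finset.sum_add_distrib, Finset.sum_sub_distrib, ← Finset.mul_sum, ← Finset.mul_sum,
    ← Finset.mul_sum, ← Finset.mul_sum] at h4
  change _ ≤ _ - q * S.lyap z + _ at h4
  rw [← Finset.mul_sum]
  linarith

/-- A static bound: it uses the untriggered conditions of all agents jointly and no dynamics, so C
is uniform over states. It controls only BᵀP e, which may have a kernel. -/
theorem exists_norm_αLin_err_le (Y : ℝ) : ∃ C, 0 ≤ C ∧ ∀ z : State n M, z.Consistent →
    (∀ i, S.trigger z i ≤ 0) → (∀ i, ‖S.αLin (z.dev i)‖ ≤ Y) → ∀ i, ‖S.αLin (err z i)‖ ≤ C := by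
  have hκ₁ := h.κ₁_pos
  have hκ₂ := h.κ₂_pos
  have hl := h.degree_pos
  set D := 4 * S.κ₂ * (1 + 2 * S.κ₂ / S.κ₁) * ∑ i, S.L i i * Y ^ 2 + ((M : ℝ) + 1) * S.ξ with hD
  have hD0 : 0 ≤ D := by
    have := h.ξ_pos
    have h2 : 0 ≤ ∑ i, S.L i i * Y ^ 2 :=
      Finset.sum_nonneg fun i _ => mul_nonneg (hl i).le (sq_nonneg _)
    positivity
  refine ⟨∑ i, √(D / (2 * S.κ₁ * S.L i i)), Finset.sum_nonneg fun i _ => Real.sqrt_nonneg _,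
    fun z hz ht hY i => ?_⟩
  have h1 : ∀ i, S.sCoeff i * ‖S.αLin (err z i)‖ ^ 2 ≤ S.θCoeff i * ‖S.αLin (S.w z i)‖ ^ 2 + S.ξ := by
    intro i
    have h4 := ht i
    rw [h.trigger_eq] at h4
    have h5 : 0 ≤ S.θCoeff i * ‖S.αLin (S.w z i)‖ ^ 2 :=
      mul_nonneg (h.θCoeff_nonneg i) (by positivity)
    have h6 : 0 ≤ 2 * S.κ * |inner ℝ (S.αLin (S.w z i)) (S.αLin (err z i))| := by
      have := h.κ_pos
      positivity
    nlinarith [h.σ_lt i]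
  have h2 := Finset.sum_le_sum fun i (_ : i ∈ Finset.univ) => h1 i
  simp only [Finset.sum_add_distrib, Finset.sum_const, Finset.card_univ, Fintype.card_fin,
    nsmul_eq_mul, Nat.cast_add, Nat.cast_one] at h2
  have h3 := h.sum_degree_mul_norm_sq_le (y := fun i => S.αLin (z.dev i))
    (η := fun i => S.αLin (err z i)) (W := fun i => S.αLin (S.w z i)) (h.map_w S.αLin hz) h2
  have h4 : ∑ i, S.L i i * ‖S.αLin (z.dev i)‖ ^ 2 ≤ ∑ i, S.L i i * Y ^ 2 :=
    Finset.sum_le_sum fun i _ => by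
      have := hl i
      have := hY i
      gcongr
  have h5 : 2 * S.κ₁ * ∑ i, S.L i i * ‖S.αLin (err z i)‖ ^ 2 ≤ D := h3.trans (by
    rw [hD]
    gcongr)
  have h6 : S.L i i * ‖S.αLin (err z i)‖ ^ 2 ≤ ∑ i, S.L i i * ‖S.αLin (err z i)‖ ^ 2 :=
    Finset.single_le_sum (f := fun i => S.L i i * ‖S.αLin (err z i)‖ ^ 2)
      (fun i _ => mul_nonneg (hl i).le (sq_nonneg _)) (Finset.mem_univ i)
  have h7 : ‖S.αLin (err z i)‖ ≤ √(D / (2 * S.κ₁ * S.L i i)) := by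
    apply Real.le_sqrt_of_sq_le
    have := hl i
    rw [le_div_iff₀ (by positivity)]
    nlinarith
  exact h7.trans (Finset.single_le_sum (f := fun i => √(D / (2 * S.κ₁ * S.L i i)))
      (fun i _ => Real.sqrt_nonneg _) (Finset.mem_univ i))

theorem norm_control_input_le (z : State n M) (i : Fin (M + 1)) :
    ‖Matrix.toEuclideanLin S.B (S.control z i)‖
      ≤ S.κ * opNorm (S.B * S.B.transpose * S.P) * ‖S.w z i‖ := by
  have hκ := h.κ_pos
  by_cases hi : i = 0
  · simp only [hi, control_zero, map_zero, norm_zero]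
    have : 0 ≤ opNorm (S.B * S.B.transpose * S.P) := norm_nonneg _
    positivity
  · have h1 : Matrix.toEuclideanLin S.B (S.αLin (S.w z i))
        = Matrix.toEuclideanCLM (n := Fin n) (𝕜 := ℝ) (S.B * S.B.transpose * S.P) (S.w z i) := by
      ext c
      simp [αLin, Matrix.mul_assoc]
    rw [control_eq h z hi, map_smul, norm_smul, Real.norm_eq_abs, abs_of_pos hκ, h1, mul_assoc]
    gcongr
    exact ContinuousLinearMap.le_opNorm _ _

theorem norm_errInput_le (z : State n M) (i : Fin (M + 1)) :
    ‖S.errInput z i‖ ≤ Δ + S.κ * opNorm (S.B * S.B.transpose * S.P) * ‖S.w z i‖ := by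
  refine (norm_add_le _ _).trans (add_le_add ?_ (h.norm_control_input_le z i))
  rw [norm_sub_rev]
  exact h.mismatch _

/-- In terms of BᵀP w rather than w: the former can be bounded while a bound on w is still the goal.
-/
theorem norm_errInput_le' (z : State n M) (i : Fin (M + 1)) :
    ‖S.errInput z i‖ ≤ Δ + ‖LinearMap.toContinuousLinearMap (Matrix.toEuclideanLin S.B)‖
      * (S.κ * ‖S.αLin (S.w z i)‖) := by
  refine (norm_add_le _ _).trans (add_le_add ?_ ?_)
  · rw [norm_sub_rev]
    exact h.mismatch _
  · have hκ := h.κ_pos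
    by_cases hi : i = 0
    · simp only [hi, control_zero, map_zero, norm_zero]
      positivity
    · rw [control_eq h z hi]
      refine (ContinuousLinearMap.le_opNorm
        (LinearMap.toContinuousLinearMap (Matrix.toEuclideanLin S.B)) _).trans ?_
      rw [norm_smul, Real.norm_eq_abs, abs_of_pos hκ]

omit h in
theorem vel_sub_eq (z : State n M) (i : Fin (M + 1)) : S.vel z i - S.f (z.est i i) S.θhat
    = (S.f (z.x i) S.θhat - S.f (z.est i i) S.θhat) + S.errInput z i := by
  simp only [vel, errInput]
  abel

/-- The vector field contracts e up to ρ|BᵀP e|²; half of the rate q is spent on the input through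
Young's inequality. -/
theorem err_dissipation (z : State n M) (i : Fin (M + 1)) {H D : ℝ}
    (hH : ‖S.αLin (err z i)‖ ≤ H) (hD : ‖S.errInput z i‖ ≤ D) :
    2 * bilin S.P (err z i) (S.vel z i - S.f (z.est i i) S.θhat)
      ≤ -(q / 2) * S.errEnergy z i + (ρ * H ^ 2 + 2 / q * (opNorm S.P * D ^ 2)) := by
  have hq := h.q_pos
  have hρ := h.ρ_pos
  have h1 := h.incremental_hat (z.x i) (z.est i i)
  rw [bilin_Q h.isSymm_P, real_inner_self_eq_norm_sq] at h1
  change 2 * bilin S.P (err z i) _ ≤ ρ * ‖S.αLin (err z i)‖ ^ 2 - q * S.errEnergy z i at h1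
  have h2 := two_mul_bilin_le h.posDef (half_pos hq) (err z i) (S.errInput z i)
  have h3 : bilin S.P (S.errInput z i) (S.errInput z i) ≤ opNorm S.P * D ^ 2 := by
    refine (le_abs_self _).trans ((abs_bilin_le _ _ _).trans ?_)
    have : 0 ≤ opNorm S.P := norm_nonneg _
    rw [mul_assoc, ← sq]
    gcongr
  have h4 : ρ * ‖S.αLin (err z i)‖ ^ 2 ≤ ρ * H ^ 2 := by gcongr
  have h5 : 1 / (q / 2) * bilin S.P (S.errInput z i) (S.errInput z i)
      ≤ 2 / q * (opNorm S.P * D ^ 2) := by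
    rw [one_div_div]
    gcongr
  have h6 : bilin S.P (err z i) (err z i) = S.errEnergy z i := rfl
  rw [h6] at h2
  rw [vel_sub_eq, bilin_add_right]
  linarith

theorem norm_err_vel_le (z : State n M) (i : Fin (M + 1)) {w : ℝ} (hw : ‖S.w z i‖ ≤ w) :
    ‖S.vel z i - S.f (z.est i i) S.θhat‖
      ≤ k * ‖err z i‖ + (S.κ * opNorm (S.B * S.B.transpose * S.P) * w + Δ) := by
  rw [vel_sub_eq]
  refine (norm_add_le _ _).trans (add_le_add (h.lip_hat _ _) ?_)
  refine (h.norm_errInput_le z i).trans ?_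
  have hκ := h.κ_pos
  have : 0 ≤ opNorm (S.B * S.B.transpose * S.P) := norm_nonneg _
  rw [add_comm]
  gcongr

end Admissible

namespace System.IsFlow

variable {S : System n m p M} {z : ℝ → State n M} {t₀ : ℝ} (hz : S.IsFlow z t₀)
include hz

theorem hasDerivWithinAt_dev (i : Fin (M + 1)) {t : ℝ} (ht : t₀ ≤ t) :
    HasDerivWithinAt (fun s => (z s).dev i) (S.vel (z t) i - S.vel (z t) 0) (Ici t₀) t :=
  (hz.1 t ht i).sub (hz.1 t ht 0)

theorem hasDerivWithinAt_err (i : Fin (M + 1)) {t : ℝ} (ht : t₀ ≤ t) :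
    HasDerivWithinAt (fun s => err (z s) i) (S.vel (z t) i - S.f ((z t).est i i) S.θhat)
      (Ici t₀) t :=
  (hz.1 t ht i).sub (hz.2 t ht i i)

theorem hasDerivWithinAt_lyap (hP : S.P.IsSymm) {t : ℝ} (ht : t₀ ≤ t) :
    HasDerivWithinAt (fun s => S.lyap (z s))
      (∑ i, 2 * bilin S.P ((z t).dev i) (S.vel (z t) i - S.vel (z t) 0)) (Ici t₀) t :=
  HasDerivWithinAt.fun_sum fun i _ =>
    hasDerivWithinAt_bilin_self hP (hz.hasDerivWithinAt_dev i ht)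

theorem hasDerivWithinAt_errEnergy (hP : S.P.IsSymm) (i : Fin (M + 1)) {t : ℝ} (ht : t₀ ≤ t) :
    HasDerivWithinAt (fun s => S.errEnergy (z s) i)
      (2 * bilin S.P (err (z t) i) (S.vel (z t) i - S.f ((z t).est i i) S.θhat)) (Ici t₀) t :=
  hasDerivWithinAt_bilin_self hP (hz.hasDerivWithinAt_err i ht)

theorem continuousOn_trigger (i : Fin (M + 1)) :
    ContinuousOn (fun s => S.trigger (z s) i) (Ici t₀) := by
  have h1 : ContinuousOn (fun s => err (z s) i) (Ici t₀) := fun t ht =>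
    (hz.hasDerivWithinAt_err i ht).continuousWithinAt
  have h2 : ∀ j, ContinuousOn (fun s => (z s).est i j) (Ici t₀) := fun j t ht =>
    (hz.2 t ht i j).continuousWithinAt
  have h3 : ContinuousOn (fun s => S.w (z s) i) (Ici t₀) :=
    continuousOn_finsetSum _ fun j _ => by
      have hi := h2 i
      have hj := h2 j
      fun_prop
  have h4 : ∀ (A : Matrix (Fin n) (Fin n) ℝ) {u v : ℝ → Vec n}, ContinuousOn u (Ici t₀) →
      ContinuousOn v (Ici t₀) → ContinuousOn (fun s => bilin A (u s) (v s)) (Ici t₀) := by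
    intro A u v hu hv
    simp only [bilin_eq_inner]
    exact hu.inner ((ContinuousLinearMap.continuous _).comp_continuousOn hv)
  exact (((h4 _ h1 h1).add (h4 _ h3 h1).abs).sub (continuousOn_const.mul (h4 _ h3 h3))).sub
    continuousOn_const

end System.IsFlow

end LeaderFollower

/-! ### Event structure and existence of solutions -/

namespace LeaderFollower

open LeaderFollower.System

variable {n m p M : ℕ} {S : System n m p M} {x₀ : Config n M}

theorem System.le_triggerTime (z : ℝ → State n M) (t₀ : ℝ) (i : Fin (M + 1)) :
    (t₀ : EReal) ≤ S.triggerTime z t₀ i := by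
  refine le_sInf ?_
  rintro _ ⟨s, hs, rfl⟩
  exact EReal.coe_le_coe_iff.2 hs.1.le

theorem System.trigger_nonpos_of_lt_triggerTime {z : ℝ → State n M} {t₀ s : ℝ} {i : Fin (M + 1)}
    (h₀ : t₀ < s) (hs : (s : EReal) < S.triggerTime z t₀ i) : S.trigger (z s) i ≤ 0 := by
  by_contra hpos
  exact hs.not_ge (sInf_le ⟨s, ⟨h₀, not_le.1 hpos⟩, rfl⟩)

/-- If the quantity were negative at t, by continuity it would stay negative on some [t, u), and the
infimum would be at least u. The case t = t₀ of an immediate further communication is included. -/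
theorem System.IsFlow.trigger_nonneg {z : ℝ → State n M} {t₀ t : ℝ} {i : Fin (M + 1)}
    (hz : S.IsFlow z t₀) (ht : S.triggerTime z t₀ i = (t : EReal)) : 0 ≤ S.trigger (z t) i := by
  have h0 : t₀ ≤ t := EReal.coe_le_coe_iff.1 (ht ▸ S.le_triggerTime z t₀ i)
  by_contra hneg
  have hc := (hz.continuousOn_trigger i t h0).mono (Ici_subset_Ici.2 h0)
  have hev : ∀ᶠ s in 𝓝[≥] t, S.trigger (z s) i < 0 := hc (Iio_mem_nhds (not_le.1 hneg))
  obtain ⟨u, hu, hsub⟩ := mem_nhdsGE_iff_exists_Ico_subset.1 hev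
  have hle : (u : EReal) ≤ S.triggerTime z t₀ i := by
    refine le_sInf ?_
    rintro _ ⟨s, hs, rfl⟩
    have hts : t ≤ s := EReal.coe_le_coe_iff.1 (ht ▸ sInf_le ⟨s, hs, rfl⟩)
    by_contra hsu
    have hsu' : s < u := EReal.coe_lt_coe_iff.1 (not_le.1 hsu)
    have hneg' : S.trigger (z s) i < 0 := hsub ⟨hts, hsu'⟩
    exact lt_asymm hs.2 hneg'
  rw [ht] at hle
  exact (EReal.coe_le_coe_iff.1 hle).not_gt hu

namespace Solution

variable (Z : Solution S x₀)

theorem time_le_succ (k : ℕ) : Z.time k ≤ Z.time (k + 1) := by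
  induction hk : Z.time k with
  | top => rw [Z.time_top k hk]
  | bot => exact bot_le
  | coe t =>
    rw [Z.time_succ k t hk]
    exact le_iInf fun i => S.le_triggerTime _ _ _

theorem time_mono : Monotone Z.time := monotone_nat_of_le_succ Z.time_le_succ

theorem zero_le_time (k : ℕ) : 0 ≤ Z.time k := by
  have h := Z.time_mono (Nat.zero_le k)
  rwa [Z.time_zero] at h

/-- `[time k, time (k + 1)]` contains `t`. -/
def Active (k : ℕ) (t : ℝ) : Prop := Z.time k ≤ (t : EReal) ∧ (t : EReal) ≤ Z.time (k + 1)

theorem exists_time_eq {k : ℕ} (h : Z.time k ≠ ⊤) : ∃ a : ℝ, Z.time k = (a : EReal) ∧ 0 ≤ a := by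
  have h0 := Z.zero_le_time k
  have hb : Z.time k ≠ ⊥ := fun hb => by
    rw [hb] at h0
    exact absurd h0 (by simp)
  refine ⟨(Z.time k).toReal, (EReal.coe_toReal h hb).symm, EReal.toReal_nonneg h0⟩

variable {Z}

theorem Active.exists_time_eq {k : ℕ} {t : ℝ} (h : Z.Active k t) :
    ∃ a : ℝ, Z.time k = (a : EReal) ∧ 0 ≤ a ∧ a ≤ t := by
  obtain ⟨a, ha, h0⟩ := Z.exists_time_eq (ne_top_of_le_ne_top (EReal.coe_ne_top t) h.1)
  exact ⟨a, ha, h0, EReal.coe_le_coe_iff.1 (ha ▸ h.1)⟩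

theorem active_of_time_succ {k : ℕ} {t : ℝ} (h : Z.time (k + 1) = (t : EReal)) : Z.Active k t :=
  ⟨h ▸ Z.time_le_succ k, h.ge⟩

/-- Induction along a solution, from event `j` on. -/
theorem active_induction {Pr : ℕ → ℝ → Prop} {j : ℕ} {b : ℝ} (hj : Z.time j = (b : EReal))
    (start : Pr j b)
    (evolve : ∀ (k : ℕ) (a t : ℝ), j ≤ k → Z.time k = (a : EReal) → a < t → (t : EReal) ≤ Z.time (k + 1) →
      Pr k a → Pr k t)
    (jump : ∀ (k : ℕ) (t : ℝ), j ≤ k → Z.time (k + 1) = (t : EReal) → Pr k t → Pr (k + 1) t)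
    {k : ℕ} (hk : j ≤ k) : ∀ {t : ℝ}, Z.Active k t → Pr k t := by
  have ext : ∀ (k : ℕ) (a : ℝ), j ≤ k → Z.time k = (a : EReal) → Pr k a →
      ∀ {t : ℝ}, Z.Active k t → Pr k t := by
    intro k a hjk ha hPr t ht
    -- Intervals of length zero between simultaneous events carry no evolution, so `evolve` may
    -- assume a < t.
    rcases (EReal.coe_le_coe_iff.1 (ha ▸ ht.1)).eq_or_lt with rfl | hlt
    · exact hPr
    · exact evolve k a t hjk ha hlt ht.2 hPr
  induction k, hk using Nat.le_induction with
  | base => exact ext j b le_rfl hj start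
  | succ k hjk ih =>
    intro t ht
    obtain ⟨a, ha, -, -⟩ := ht.exists_time_eq
    exact ext (k + 1) a (by omega) ha (jump k a hjk ha (ih (active_of_time_succ ha))) ht

/-- Continuity extends the inequality from the open interval to both ends. For a = t it can fail: a
received message may leave the condition violated until the next simultaneous event. -/
theorem trigger_nonpos {k : ℕ} {a t : ℝ} (ha : Z.time k = (a : EReal)) (hat : a < t)
    (ht : (t : EReal) ≤ Z.time (k + 1)) {s : ℝ} (hs : s ∈ Icc a t) (i : Fin (M + 1)) :
    S.trigger (Z.flow k s) i ≤ 0 := by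
  have hc : ContinuousOn (fun s => S.trigger (Z.flow k s) i) (closure (Ioo a t)) := by
    rw [closure_Ioo hat.ne]
    exact ((Z.isFlow k a ha).continuousOn_trigger i).mono Icc_subset_Ici_self
  refine le_on_closure (s := Ioo a t) (f := fun s => S.trigger (Z.flow k s) i) (g := fun _ => 0)
    (fun r hr => ?_) hc continuousOn_const (by rwa [closure_Ioo hat.ne])
  refine S.trigger_nonpos_of_lt_triggerTime hr.1 (lt_of_lt_of_le (EReal.coe_lt_coe_iff.2 hr.2) ?_)
  rw [Z.time_succ k a ha] at ht
  exact ht.trans (iInf_le _ i)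

theorem flow_succ_x {k : ℕ} {t : ℝ} (ht : Z.time (k + 1) = (t : EReal)) :
    (Z.flow (k + 1) t).x = (Z.flow k t).x := by
  rw [Z.reset k t ht]; rfl

theorem flow_succ_dev {k : ℕ} {t : ℝ} (ht : Z.time (k + 1) = (t : EReal)) (i : Fin (M + 1)) :
    (Z.flow (k + 1) t).dev i = (Z.flow k t).dev i := by
  simp only [State.dev, flow_succ_x ht]

theorem flow_succ_err_of_mem {k : ℕ} {t : ℝ} (ht : Z.time (k + 1) = (t : EReal)) {i : Fin (M + 1)}
    (hi : i ∈ Z.comm (k + 1)) : err (Z.flow (k + 1) t) i = 0 := by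
  rw [Z.reset k t ht]
  simp [err, broadcast, hi]

theorem flow_succ_err {k : ℕ} {t : ℝ} (ht : Z.time (k + 1) = (t : EReal)) (i : Fin (M + 1)) :
    err (Z.flow (k + 1) t) i = 0 ∨ err (Z.flow (k + 1) t) i = err (Z.flow k t) i := by
  by_cases hi : i ∈ Z.comm (k + 1)
  · exact Or.inl (flow_succ_err_of_mem ht hi)
  · right
    rw [Z.reset k t ht]
    simp [err, broadcast, hi]

theorem err_eq_zero_of_mem {j : ℕ} {b : ℝ} (hb : Z.time j = (b : EReal)) {i : Fin (M + 1)}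
    (hi : i ∈ Z.comm j) : err (Z.flow j b) i = 0 := by
  cases j with
  | zero =>
    have h0 : b = 0 := by
      rw [Z.time_zero] at hb
      exact (EReal.coe_eq_coe_iff.1 hb).symm
    rw [h0, err, Z.init, Z.init_est, sub_self]
  | succ j => exact flow_succ_err_of_mem hb hi

theorem exists_time_eq_of_mem {j : ℕ} {i : Fin (M + 1)} (hi : i ∈ Z.comm j) :
    ∃ b : ℝ, Z.time j = (b : EReal) ∧ 0 ≤ b := by
  refine Z.exists_time_eq fun h => ?_
  rw [Z.comm_top j h] at hi
  exact hi

/-- When an agent communicates, its triggering condition is met. -/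
theorem trigger_nonneg_of_mem {k : ℕ} {i : Fin (M + 1)} (hi : i ∈ Z.comm (k + 1)) :
    ∃ t : ℝ, Z.time (k + 1) = (t : EReal) ∧ 0 ≤ S.trigger (Z.flow k t) i := by
  obtain ⟨t, ht, -⟩ := exists_time_eq_of_mem hi
  obtain ⟨a, ha, -, -⟩ := (active_of_time_succ ht).exists_time_eq
  rw [Z.comm_succ k a t ha ht] at hi
  exact ⟨t, ht, (Z.isFlow k a ha).trigger_nonneg hi⟩

/-- The infimum over the finitely many agents is attained. -/
theorem comm_nonempty {k : ℕ} {t : ℝ} (ht : Z.time (k + 1) = (t : EReal)) :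
    (Z.comm (k + 1)).Nonempty := by
  obtain ⟨a, ha, -, -⟩ := (active_of_time_succ ht).exists_time_eq
  obtain ⟨i, hi⟩ := exists_eq_ciInf_of_finite (f := fun i => S.triggerTime (Z.flow k) a i)
  refine ⟨i, ?_⟩
  rw [Z.comm_succ k a t ha ht, ← ht, Z.time_succ k a ha]
  exact hi

end Solution

namespace Admissible

variable {μ q ρ k Δ : ℝ} (h : Admissible S μ q ρ k Δ)
include h

theorem lipschitzWith_hat : LipschitzWith k.toNNReal fun x => S.f x S.θhat :=
  LipschitzWith.of_dist_le_mul fun x y => by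
    rw [dist_eq_norm, dist_eq_norm, Real.coe_toNNReal k h.k_pos.le]
    exact h.lip_hat x y

theorem lipschitzWith : LipschitzWith k.toNNReal fun x => S.f x S.θ :=
  LipschitzWith.of_dist_le_mul fun x y => by
    rw [dist_eq_norm, dist_eq_norm, Real.coe_toNNReal k h.k_pos.le]
    exact h.lip x y

theorem exists_flow (t₀ : ℝ) (z₀ : State n M) : ∃ z : ℝ → State n M, S.IsFlow z t₀ ∧ z t₀ = z₀ :=
  S.exists_flow h.smooth h.smooth_hat h.lipschitzWith h.lipschitzWith_hat t₀ z₀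

open Classical in
/-- The closed loop has a solution from every initial state. -/
theorem nonempty_solution (x₀ : Config n M) : Nonempty (Solution S x₀) := by
  choose ev hev hev₀ using h.exists_flow
  let nextTime : EReal → (ℝ → State n M) → EReal := fun T z =>
    if T = ⊤ then ⊤ else ⨅ i, S.triggerTime z T.toReal i
  let nextComm : EReal → (ℝ → State n M) → Set (Fin (M + 1)) := fun T z =>
    if nextTime T z = ⊤ then ∅ else {i | S.triggerTime z T.toReal i = nextTime T z}
  let nextFlow : EReal → (ℝ → State n M) → ℝ → State n M := fun T z =>
    ev (nextTime T z).toReal (broadcast (nextComm T z) (z (nextTime T z).toReal))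
  let z₀ : State n M := ⟨x₀, fun _ j => x₀ j⟩
  let run : ℕ → EReal × Set (Fin (M + 1)) × (ℝ → State n M) := fun k =>
    Nat.rec (((0 : ℝ) : EReal), univ, ev 0 z₀)
      (fun _ d => (nextTime d.1 d.2.2, nextComm d.1 d.2.2, nextFlow d.1 d.2.2)) k
  have hrun : ∀ k, run (k + 1) = (nextTime (run k).1 (run k).2.2,
      nextComm (run k).1 (run k).2.2, nextFlow (run k).1 (run k).2.2) := fun k => rfl
  have hrun₀ : run 0 = (((0 : ℝ) : EReal), univ, ev 0 z₀) := rfl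
  clear_value run
  refine ⟨{ time := fun k => (run k).1, comm := fun k => (run k).2.1, flow := fun k => (run k).2.2,
            time_zero := ?_, comm_zero := ?_, init := ?_, init_est := ?_, isFlow := ?_,
            time_succ := ?_, comm_succ := ?_, reset := ?_, time_top := ?_, comm_top := ?_ }⟩
  · rw [hrun₀]
  · rw [hrun₀]
  · simp only [hrun₀, hev₀, z₀]
  · intro i j
    simp only [hrun₀, hev₀, z₀]
  · intro k t ht
    cases k with
    | zero =>
      rw [hrun₀] at ht ⊢
      have h0 : t = 0 := (EReal.coe_eq_coe_iff.1 ht).symm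
      subst h0
      exact hev _ _
    | succ k =>
      simp only [hrun] at ht ⊢
      simp only [nextFlow, ht, EReal.toReal_coe]
      exact hev _ _
  · intro k t ht
    simp only [hrun, nextTime, ht, EReal.coe_ne_top, if_false, EReal.toReal_coe]
  · intro k t t' ht ht'
    simp only [hrun] at ht' ⊢
    rw [ht] at ht' ⊢
    simp only [nextComm, ht', EReal.coe_ne_top, if_false, EReal.toReal_coe]
  · intro k t' ht'
    simp only [hrun] at ht' ⊢
    simp only [nextFlow, ht', EReal.toReal_coe, hev₀]
  · intro k hk
    simp only [hrun, nextTime, hk, if_true]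
  · intro k hk
    cases k with
    | zero =>
      rw [hrun₀] at hk
      exact absurd hk (EReal.coe_ne_top _)
    | succ k =>
      simp only [hrun] at hk ⊢
      simp only [nextComm, hk, if_true]

end Admissible

end LeaderFollower

/-! ### Bounds along solutions, inter-event times and practical consensus -/

namespace LeaderFollower

open LeaderFollower.System LeaderFollower.Solution

variable {n m p M : ℕ} {S : System n m p M} {x₀ : Config n M}

/-- Compare with the consensus point at which every agent sits at the leader's state. -/
theorem infDist_consensus_sq_le (x : Config n M) : distConsensus x ^ 2 ≤ ∑ i, ‖x i - x 0‖ ^ 2 := by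
  have h1 : distConsensus x ≤ dist x (WithLp.toLp 2 fun _ => x 0) :=
    Metric.infDist_le_dist_of_mem fun _ _ => rfl
  have h2 : dist x (WithLp.toLp 2 fun _ => x 0) ^ 2 = ∑ i, ‖x i - x 0‖ ^ 2 := by
    rw [dist_eq_norm, PiLp.norm_sq_eq_of_L2]
    rfl
  rw [← h2]
  have h3 : 0 ≤ distConsensus x := Metric.infDist_nonneg
  gcongr

namespace Admissible

variable {μ q ρ k Δ : ℝ} (h : Admissible S μ q ρ k Δ) (Z : Solution S x₀)
include h

variable {Z} in
-- All copies of an estimate start equal, solve the same equation and are reset by the same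
-- broadcasts.
theorem consistent {l : ℕ} {t : ℝ} (ht : Z.Active l t) : (Z.flow l t).Consistent := by
  refine active_induction (Pr := fun l t => (Z.flow l t).Consistent) Z.time_zero ?_ ?_ ?_
    (Nat.zero_le l) ht
  · intro i j
    rw [Z.init_est, Z.init_est]
  · intro l a t _ ha hat _ hc i j
    exact (Z.isFlow l a ha).est_eq h.lipschitzWith_hat (hc i j) hat.le
  · intro l t _ ht hc i j
    rw [Z.reset l t ht]
    by_cases hj : j ∈ Z.comm (l + 1)
    · simp [broadcast, hj]
    · simpa [broadcast, hj] using hc i j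

variable {Z} in
/-- Exponential decay of the Lyapunov function up to `N ξ / q`. -/
theorem lyap_le {l : ℕ} {t : ℝ} (ht : Z.Active l t) :
    S.lyap (Z.flow l t) ≤ ((M : ℝ) + 1) * S.ξ / q
      + Real.exp (-(q * t)) * (S.lyap (Z.flow 0 0) - ((M : ℝ) + 1) * S.ξ / q) := by
  have key : Real.exp (q * t) * (S.lyap (Z.flow l t) - ((M : ℝ) + 1) * S.ξ / q)
      ≤ S.lyap (Z.flow 0 0) - ((M : ℝ) + 1) * S.ξ / q := by
    refine active_induction (Pr := fun l t => Real.exp (q * t) * (S.lyap (Z.flow l t)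
      - ((M : ℝ) + 1) * S.ξ / q) ≤ S.lyap (Z.flow 0 0) - ((M : ℝ) + 1) * S.ξ / q)
      Z.time_zero (by simp) ?_ ?_ (Nat.zero_le l) ht
    · intro l a t _ ha hat hte hPr
      have hd := fun s (hs : s ∈ Icc a t) =>
        (Z.isFlow l a ha).hasDerivWithinAt_lyap h.isSymm_P hs.1
      refine (exp_mul_sub_le_of_hasDerivWithinAt h.q_pos (b := t)
        (fun s hs => (hd s hs).continuousWithinAt.mono Icc_subset_Ici_self)
        (fun s hs => hd s (Ioo_subset_Icc_self hs)) (fun s hs => ?_) ⟨hat.le, le_rfl⟩).trans hPr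
      exact h.dissipation (h.consistent ⟨ha.le.trans (EReal.coe_le_coe_iff.2 hs.1.le),
        (EReal.coe_le_coe_iff.2 hs.2.le).trans hte⟩)
        (trigger_nonpos ha hat hte (Ioo_subset_Icc_self hs))
    · intro l t _ ht hPr
      simpa only [lyap, flow_succ_dev ht] using hPr
  have h1 : Real.exp (-(q * t)) * Real.exp (q * t) = 1 := by
    rw [← Real.exp_add]; simp
  have h2 := mul_le_mul_of_nonneg_left key (Real.exp_pos (-(q * t))).le
  rw [← mul_assoc, h1, one_mul] at h2
  linarith

theorem exists_norm_dev_le : ∃ X, 0 ≤ X ∧ ∀ l t, Z.Active l t → ∀ i, ‖(Z.flow l t).dev i‖ ≤ X := by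
  obtain ⟨c, hc, hcP⟩ := exists_mul_norm_sq_le_bilin h.posDef
  set D := ((M : ℝ) + 1) * S.ξ / q with hD
  refine ⟨√((D + |S.lyap (Z.flow 0 0) - D|) / c), Real.sqrt_nonneg _, fun l t ht i => ?_⟩
  apply Real.le_sqrt_of_sq_le
  rw [le_div_iff₀ hc, mul_comm]
  obtain ⟨a, -, ha0, hat⟩ := ht.exists_time_eq
  have h1 := h.lyap_le ht
  have h2 : bilin S.P ((Z.flow l t).dev i) ((Z.flow l t).dev i) ≤ S.lyap (Z.flow l t) :=
    Finset.single_le_sum (f := fun i => bilin S.P ((Z.flow l t).dev i) ((Z.flow l t).dev i))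
      (fun _ _ => h.posDef.posSemidef.bilin_nonneg _) (Finset.mem_univ i)
  have h3 : Real.exp (-(q * t)) ≤ 1 := by
    rw [Real.exp_le_one_iff]
    have := mul_nonneg h.q_pos.le (ha0.trans hat)
    linarith
  have h4 : Real.exp (-(q * t)) * (S.lyap (Z.flow 0 0) - D) ≤ 1 * |S.lyap (Z.flow 0 0) - D| :=
    (mul_le_mul_of_nonneg_left (le_abs_self _) (Real.exp_pos _).le).trans
      (mul_le_mul_of_nonneg_right h3 (abs_nonneg _))
  linarith [hcP ((Z.flow l t).dev i)]

/-- The deviations from the leader and the errors stay bounded. -/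
theorem exists_bounds : ∃ X E, ∀ l t, Z.Active l t →
    (∀ i, ‖(Z.flow l t).dev i‖ ≤ X) ∧ (∀ i, ‖err (Z.flow l t) i‖ ≤ E) := by
  obtain ⟨X, hX0, hX⟩ := h.exists_norm_dev_le Z
  set A : Vec n →L[ℝ] Vec m := LinearMap.toContinuousLinearMap S.αLin with hA
  have hAle : ∀ v, ‖S.αLin v‖ ≤ ‖A‖ * ‖v‖ := fun v => A.le_opNorm v
  have hY : ∀ l t, Z.Active l t → ∀ i, ‖S.αLin ((Z.flow l t).dev i)‖ ≤ ‖A‖ * X :=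
    fun l t ht i => (hAle _).trans (by gcongr; exact hX l t ht i)
  obtain ⟨H, hH0, hH⟩ := h.exists_norm_αLin_err_le (‖A‖ * X)
  have hz0 : ∀ i, err (Z.flow 0 0) i = 0 := fun i => by
    rw [err, Z.init, Z.init_est, sub_self]
  -- On intervals of positive length this is the static bound. The induction is for intervals of
  -- length zero, which inherit it because a jump either keeps an error or sets it to zero.
  have hHb : ∀ l t, Z.Active l t → ∀ i, ‖S.αLin (err (Z.flow l t) i)‖ ≤ H := by
    intro l t ht
    refine active_induction (Pr := fun l t => ∀ i, ‖S.αLin (err (Z.flow l t) i)‖ ≤ H)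
      Z.time_zero ?_ ?_ ?_ (Nat.zero_le l) ht
    · intro i
      simpa [hz0] using hH0
    · intro l a t _ ha hat hte _
      have hact : Z.Active l t := ⟨ha.le.trans (EReal.coe_le_coe_iff.2 hat.le), hte⟩
      exact hH _ (h.consistent hact) (trigger_nonpos ha hat hte ⟨hat.le, le_rfl⟩) (hY l t hact)
    · intro l t _ ht hPr i
      rcases flow_succ_err ht i with he | he
      · simpa [he] using hH0
      · rw [he]; exact hPr i
  obtain ⟨D, hD⟩ : ∃ D, ∀ l t, Z.Active l t → ∀ i, ‖S.errInput (Z.flow l t) i‖ ≤ D := by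
    refine ⟨∑ i, (Δ + ‖LinearMap.toContinuousLinearMap (Matrix.toEuclideanLin S.B)‖
      * (S.κ * ((∑ j, |S.L i j|) * (‖A‖ * X + H)))), fun l t ht i => ?_⟩
    have hκ := h.κ_pos
    have hΔ := h.Δ_nonneg
    refine (h.norm_errInput_le' _ i).trans (le_trans ?_ (Finset.single_le_sum
      (f := fun i => Δ + ‖LinearMap.toContinuousLinearMap (Matrix.toEuclideanLin S.B)‖
      * (S.κ * ((∑ j, |S.L i j|) * (‖A‖ * X + H)))) (fun i _ => by positivity)
      (Finset.mem_univ i)))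
    gcongr
    exact h.norm_map_w_le S.αLin (h.consistent ht) (hY l t ht) (hHb l t ht) i
  set C := ρ * H ^ 2 + 2 / q * (opNorm S.P * D ^ 2) with hC
  have hq := h.q_pos
  have hρ := h.ρ_pos
  have hC0 : 0 ≤ C / (q / 2) := by
    have : 0 ≤ opNorm S.P := norm_nonneg _
    positivity
  -- The sublevel set is invariant under the flow, and jumps do not raise the energy.
  have hEb : ∀ l t, Z.Active l t → ∀ i, S.errEnergy (Z.flow l t) i ≤ C / (q / 2) := by
    intro l t ht
    refine active_induction (Pr := fun l t => ∀ i, S.errEnergy (Z.flow l t) i ≤ C / (q / 2))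
      Z.time_zero ?_ ?_ ?_ (Nat.zero_le l) ht
    · intro i
      simpa [errEnergy, hz0, bilin] using hC0
    · intro l a t _ ha hat hte hPr i
      have hact : ∀ s ∈ Ioo a t, Z.Active l s := fun s hs =>
        ⟨ha.le.trans (EReal.coe_le_coe_iff.2 hs.1.le), (EReal.coe_le_coe_iff.2 hs.2.le).trans hte⟩
      have hd := fun s (hs : s ∈ Icc a t) =>
        (Z.isFlow l a ha).hasDerivWithinAt_errEnergy h.isSymm_P i hs.1
      have h1 := exp_mul_sub_le_of_hasDerivWithinAt (half_pos hq) (b := t) (C := C)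
        (fun s hs => (hd s hs).continuousWithinAt.mono Icc_subset_Ici_self)
        (fun s hs => hd s (Ioo_subset_Icc_self hs)) (fun s hs =>
          h.err_dissipation _ i (hHb l s (hact s hs) i) (hD l s (hact s hs) i))
        ⟨hat.le, le_rfl⟩
      have h2 : Real.exp (q / 2 * a) * (S.errEnergy (Z.flow l a) i - C / (q / 2)) ≤ 0 :=
        mul_nonpos_of_nonneg_of_nonpos (Real.exp_pos _).le (by linarith [hPr i])
      have h3 := nonpos_of_mul_nonpos_right (h1.trans h2) (Real.exp_pos _)
      linarith
    · intro l t _ ht hPr i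
      rcases flow_succ_err ht i with he | he
      · simpa [errEnergy, he, bilin] using hC0
      · rw [errEnergy, he]; exact hPr i
  obtain ⟨c, hc, hcP⟩ := exists_mul_norm_sq_le_bilin h.posDef
  refine ⟨X, √(C / (q / 2) / c), fun l t ht => ⟨hX l t ht, fun i => Real.le_sqrt_of_sq_le ?_⟩⟩
  rw [le_div_iff₀ hc, mul_comm]
  exact (hcP _).trans (hEb l t ht i)

theorem bddAbove_wValues (i : Fin (M + 1)) : BddAbove (Z.wValues i) := by
  obtain ⟨X, E, hb⟩ := h.exists_bounds Z
  refine ⟨(∑ j, |S.L i j|) * (X + E), ?_⟩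
  rintro _ ⟨l, t, h1, h2, rfl⟩
  exact h.norm_map_w_le LinearMap.id (h.consistent ⟨h1, h2⟩) (hb l t ⟨h1, h2⟩).1
    (hb l t ⟨h1, h2⟩).2 i

variable {Z}

theorem norm_w_le {l : ℕ} {t : ℝ} (ht : Z.Active l t) (i : Fin (M + 1)) :
    ‖S.w (Z.flow l t) i‖ ≤ Z.wMax i :=
  le_csSup (h.bddAbove_wValues Z i) ⟨l, t, ht.1, ht.2, rfl⟩

omit h in
theorem active_zero : Z.Active 0 0 :=
  ⟨Z.time_zero.le, Z.time_zero.ge.trans (Z.time_le_succ 0)⟩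

theorem wMax_nonneg (i : Fin (M + 1)) : 0 ≤ Z.wMax i :=
  (norm_nonneg _).trans (h.norm_w_le active_zero i)

theorem ν_nonneg (i : Fin (M + 1)) : 0 ≤ Z.ν k Δ i := by
  have h1 := h.wMax_nonneg (Z := Z) i
  have h2 := h.κ_pos
  have h3 : 0 ≤ opNorm (S.B * S.B.transpose * S.P) := norm_nonneg _
  have h4 := h.Δ_nonneg
  have h5 := h.k_pos
  unfold Solution.ν
  positivity

/-- Growth of the error of an agent after it has communicated. -/
theorem norm_err_le {j : ℕ} {b : ℝ} (hb : Z.time j = (b : EReal)) {i : Fin (M + 1)}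
    (hi : i ∈ Z.comm j) {l : ℕ} (hjl : j ≤ l) {t : ℝ} (ht : Z.Active l t) :
    ‖err (Z.flow l t) i‖ ≤ Z.ν k Δ i * (Real.exp (k * (t - b)) - 1) := by
  have hk := h.k_pos
  have hν := h.ν_nonneg (Z := Z) i
  have hνk : S.κ * opNorm (S.B * S.B.transpose * S.P) * Z.wMax i + Δ = k * Z.ν k Δ i := by
    unfold Solution.ν; field_simp
  refine (active_induction (Pr := fun l t => b ≤ t ∧ ‖err (Z.flow l t) i‖
    ≤ Z.ν k Δ i * (Real.exp (k * (t - b)) - 1)) hb ?_ ?_ ?_ hjl ht).2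
  · exact ⟨le_rfl, by simp [err_eq_zero_of_mem hb hi]⟩
  · rintro l a t - ha hat hte ⟨hba, hPr⟩
    refine ⟨hba.trans hat.le, ?_⟩
    have hd := fun s (hs : a ≤ s) => (Z.isFlow l a ha).hasDerivWithinAt_err i hs
    have h1 := norm_le_gronwallBound_of_norm_deriv_right_le (b := t)
      (fun s hs => (hd s hs.1).continuousWithinAt.mono Icc_subset_Ici_self)
      (fun s hs => (hd s hs.1).mono (Ici_subset_Ici.2 hs.1)) hPr
      (fun s hs => h.norm_err_vel_le _ i (h.norm_w_le ⟨ha.le.trans (EReal.coe_le_coe_iff.2 hs.1),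
        (EReal.coe_le_coe_iff.2 hs.2.le).trans hte⟩ i)) t ⟨hat.le, le_rfl⟩
    rw [hνk, gronwallBound_of_K_ne_0 hk.ne', mul_div_cancel_left₀ _ hk.ne'] at h1
    refine h1.trans (le_of_eq ?_)
    -- The bound ν(e^{k(t-b)} - 1) solves r' = k r + kν exactly, so Grönwall on [a, t] continues it
    -- without loss across events.
    have h2 : Real.exp (k * (t - b)) = Real.exp (k * (a - b)) * Real.exp (k * (t - a)) := by
      rw [← Real.exp_add]; ring_nf
    rw [h2]; ring
  · rintro l t - ht ⟨hbt, hPr⟩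
    refine ⟨hbt, ?_⟩
    rcases flow_succ_err ht i with he | he
    · rw [he, norm_zero]
      have : 1 ≤ Real.exp (k * (t - b)) := Real.one_le_exp (mul_nonneg hk.le (by linarith))
      exact mul_nonneg hν (by linarith)
    · rwa [he]

theorem ξ_le_δ_of_trigger_nonneg {z : State n M} {i : Fin (M + 1)} (ht : 0 ≤ S.trigger z i) :
    S.ξ ≤ S.δ z i := by
  have h1 : 0 ≤ S.σ i * bilin (S.Θ i) (S.w z i) (S.w z i) := by
    refine mul_nonneg (h.σ_pos i).le ?_
    unfold System.Θ
    rw [bilin_smul, bilin_Q h.isSymm_P, real_inner_self_eq_norm_sq]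
    exact mul_nonneg (h.θCoeff_nonneg i) (sq_nonneg _)
  unfold System.trigger at ht
  linarith

/-- The condition that a communication imposes on the time elapsed since an earlier one. -/
theorem ξ_le_of_mem {i : Fin (M + 1)} {j l : ℕ} (hjl : j < l) (hj : i ∈ Z.comm j)
    (hl : i ∈ Z.comm l) : ∃ b t : ℝ, Z.time j = (b : EReal) ∧ Z.time l = (t : EReal) ∧
      S.ξ ≤ Z.c₁ k Δ i * (Real.exp (k * (t - b)) - 1) ^ 2
        + Z.c₂ k Δ i * (Real.exp (k * (t - b)) - 1) := by
  -- The condition is evaluated along the flow preceding event l, before the reset makes the error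
  -- vanish.
  obtain ⟨l, rfl⟩ : ∃ l', l = l' + 1 := ⟨l - 1, by omega⟩
  obtain ⟨b, hb, -⟩ := exists_time_eq_of_mem hj
  obtain ⟨t, ht, htr⟩ := trigger_nonneg_of_mem hl
  refine ⟨b, t, hb, ht, (h.ξ_le_δ_of_trigger_nonneg htr).trans ?_⟩
  have hact := active_of_time_succ ht
  have he := h.norm_err_le hb hj (Nat.lt_succ_iff.1 hjl) hact
  have hw := h.norm_w_le hact i
  have hw0 := h.wMax_nonneg (Z := Z) i
  set g := Real.exp (k * (t - b)) - 1
  set e := err (Z.flow l t) i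
  have hS : 0 ≤ opNorm (S.Smat i) := norm_nonneg _
  have hR : 0 ≤ opNorm S.R := norm_nonneg _
  have h1 : bilin (S.Smat i) e e ≤ Z.c₁ k Δ i * g ^ 2 := by
    refine (le_abs_self _).trans ((abs_bilin_le _ _ _).trans ?_)
    calc opNorm (S.Smat i) * ‖e‖ * ‖e‖ = opNorm (S.Smat i) * ‖e‖ ^ 2 := by ring
      _ ≤ opNorm (S.Smat i) * (Z.ν k Δ i * g) ^ 2 := by gcongr
      _ = _ := by unfold Solution.c₁; ring
  have h2 : |bilin S.R (S.w (Z.flow l t) i) e| ≤ Z.c₂ k Δ i * g := by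
    refine (abs_bilin_le _ _ _).trans ?_
    calc opNorm S.R * ‖S.w (Z.flow l t) i‖ * ‖e‖ ≤ opNorm S.R * Z.wMax i * (Z.ν k Δ i * g) := by
          gcongr
      _ = _ := by unfold Solution.c₂; ring
  exact add_le_add h1 h2

omit h in
theorem c₁_nonneg (i : Fin (M + 1)) : 0 ≤ Z.c₁ k Δ i :=
  mul_nonneg (norm_nonneg _) (sq_nonneg _)

theorem c₂_nonneg (i : Fin (M + 1)) : 0 ≤ Z.c₂ k Δ i :=
  mul_nonneg (mul_nonneg (h.wMax_nonneg i) (norm_nonneg _)) (h.ν_nonneg i)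

/-- As the coefficient in S_i is positive, c₁ vanishes only if PBBᵀP = 0 or ν = 0, and each kills
c₂. -/
theorem c₂_eq_zero {i : Fin (M + 1)} (hc : Z.c₁ k Δ i = 0) : Z.c₂ k Δ i = 0 := by
  unfold Solution.c₁ at hc
  unfold Solution.c₂
  rcases mul_eq_zero.1 hc with h1 | h1
  · have h2 : S.Smat i = 0 := by
      unfold opNorm at h1
      exact (map_eq_zero_iff _ (Matrix.toEuclideanCLM (n := Fin n) (𝕜 := ℝ)).injective).1
        (norm_eq_zero.1 h1)
    have h3 : S.Q = 0 := (smul_eq_zero.1 h2).resolve_left (h.sCoeff_pos i).ne'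
    have h4 : opNorm S.R = 0 := by simp [System.R, h3, opNorm]
    rw [h4]; ring
  · rw [pow_eq_zero_iff two_ne_zero] at h1
    rw [h1, mul_zero]

theorem τ_pos {i : Fin (M + 1)} (hc : 0 < Z.c₁ k Δ i) : 0 < Z.τ k Δ i := by
  have hξ := h.ξ_pos
  have hc₂ := h.c₂_nonneg (Z := Z) i
  refine mul_pos (one_div_pos.2 h.k_pos) (Real.log_pos ?_)
  have h1 : Z.c₂ k Δ i / (2 * Z.c₁ k Δ i)
      < √(S.ξ / Z.c₁ k Δ i + Z.c₂ k Δ i ^ 2 / (4 * Z.c₁ k Δ i ^ 2)) := by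
    apply Real.lt_sqrt_of_sq_lt
    have h2 : (Z.c₂ k Δ i / (2 * Z.c₁ k Δ i)) ^ 2 = Z.c₂ k Δ i ^ 2 / (4 * Z.c₁ k Δ i ^ 2) := by
      rw [div_pow]; ring
    rw [h2]
    have h3 : 0 < S.ξ / Z.c₁ k Δ i := by positivity
    linarith
  linarith

/-- Lower bound on the time between two communications of an agent. -/
theorem time_add_τ_le {i : Fin (M + 1)} (hc : 0 < Z.c₁ k Δ i) {j l : ℕ} (hjl : j < l)
    (hj : i ∈ Z.comm j) (hl : i ∈ Z.comm l) :
    Z.time j + ((Z.τ k Δ i : ℝ) : EReal) ≤ Z.time l := by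
  obtain ⟨b, t, hb, ht, hξ⟩ := h.ξ_le_of_mem hjl hj hl
  have hbt : b ≤ t := EReal.coe_le_coe_iff.1 (hb ▸ ht ▸ Z.time_mono hjl.le)
  rw [hb, ht, ← EReal.coe_add, EReal.coe_le_coe_iff]
  have hk := h.k_pos
  have hc₂ := h.c₂_nonneg (Z := Z) i
  have hg : 0 ≤ Real.exp (k * (t - b)) - 1 := by
    have := Real.one_le_exp (mul_nonneg hk.le (sub_nonneg.2 hbt))
    linarith
  have hτ := h.τ_pos hc
  unfold Solution.τ at hτ ⊢
  set c := Z.c₁ k Δ i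
  set d := Z.c₂ k Δ i
  set r := √(S.ξ / c + d ^ 2 / (4 * c ^ 2)) with hr
  -- Completing the square in ξ ≤ c g² + d g with g = e^{k(t-b)} - 1 ≥ 0.
  have h1 : r ≤ Real.exp (k * (t - b)) - 1 + d / (2 * c) := by
    rw [hr]
    apply Real.sqrt_le_iff.2 ⟨by positivity, ?_⟩
    have h2 : S.ξ / c ≤ (Real.exp (k * (t - b)) - 1) ^ 2
        + d / c * (Real.exp (k * (t - b)) - 1) := by
      rw [div_le_iff₀ hc]
      refine hξ.trans (le_of_eq ?_)
      field_simp
    have h3 : (Real.exp (k * (t - b)) - 1 + d / (2 * c)) ^ 2 = (Real.exp (k * (t - b)) - 1) ^ 2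
        + d / c * (Real.exp (k * (t - b)) - 1) + d ^ 2 / (4 * c ^ 2) := by
      field_simp; ring
    rw [h3]; linarith
  have h4 : 0 < r + 1 - d / (2 * c) := by
    by_contra hneg
    have h5 : d / (2 * c) ≤ r := by
      rw [hr]
      apply Real.le_sqrt_of_sq_le
      have h2 : (d / (2 * c)) ^ 2 = d ^ 2 / (4 * c ^ 2) := by
        rw [div_pow]; ring
      rw [h2]
      have h3 : 0 < S.ξ / c := div_pos h.ξ_pos hc
      linarith
    linarith
  have h5 : Real.log (r + 1 - d / (2 * c)) ≤ k * (t - b) := by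
    rw [Real.log_le_iff_le_exp h4]
    linarith
  have h6 : 1 / k * Real.log (r + 1 - d / (2 * c)) ≤ 1 / k * (k * (t - b)) := by gcongr
  have h7 : 1 / k * (k * (t - b)) = t - b := by field_simp
  linarith

theorem notMem_comm {i : Fin (M + 1)} (hc : ¬ 0 < Z.c₁ k Δ i) {l : ℕ} (hl : 0 < l) :
    i ∉ Z.comm l := by
  intro hmem
  have h1 : Z.c₁ k Δ i = 0 := le_antisymm (not_lt.1 hc) (c₁_nonneg i)
  obtain ⟨b, t, -, -, hξ⟩ := h.ξ_le_of_mem hl (Z.comm_zero ▸ mem_univ i) hmem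
  rw [h1, h.c₂_eq_zero h1, zero_mul, zero_mul, add_zero] at hξ
  exact hξ.not_gt h.ξ_pos

variable (Z) in
/-- The events do not accumulate. -/
theorem exists_lt_time (T : ℝ) : ∃ l, (T : EReal) < Z.time l := by
  by_contra hcon
  push Not at hcon
  have hfin : ∀ l, ∃ a : ℝ, Z.time l = (a : EReal) ∧ 0 ≤ a := fun l =>
    Z.exists_time_eq (ne_top_of_le_ne_top (EReal.coe_ne_top T) (hcon l))
  have hne : ∀ l, ∃ i, i ∈ Z.comm (l + 1) := fun l => by
    obtain ⟨a, ha, -⟩ := hfin (l + 1)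
    exact comm_nonempty ha
  choose c hc using hne
  -- Pigeonhole: some agent takes part in infinitely many events, so its communication times grow at
  -- least like rτ_i, or, if c₁ = 0, it should not communicate at all.
  obtain ⟨i, hi⟩ := Finite.exists_infinite_fiber c
  have hinf : (c ⁻¹' {i}).Infinite := Set.infinite_coe_iff.1 hi
  have hmem : ∀ N, ∃ l, N < l ∧ i ∈ Z.comm l := fun N => by
    obtain ⟨l, hl, hNl⟩ := hinf.exists_gt N
    exact ⟨l + 1, by omega, by rw [← show c l = i from hl]; exact hc l⟩
  by_cases hpos : 0 < Z.c₁ k Δ i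
  · have hτ := h.τ_pos hpos
    have hgrow : ∀ r : ℕ, ∃ l, i ∈ Z.comm l ∧ ((r * Z.τ k Δ i : ℝ) : EReal) ≤ Z.time l := by
      intro r
      induction r with
      | zero => exact ⟨0, Z.comm_zero ▸ mem_univ i, by simp [Z.time_zero]⟩
      | succ r ih =>
        obtain ⟨l, hl, hle⟩ := ih
        obtain ⟨l', hll', hl'⟩ := hmem l
        refine ⟨l', hl', le_trans ?_ (h.time_add_τ_le hpos hll' hl hl')⟩
        have : ((r + 1 : ℕ) * Z.τ k Δ i : ℝ) = r * Z.τ k Δ i + Z.τ k Δ i := by push_cast; ring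
        rw [this, EReal.coe_add]
        gcongr
    obtain ⟨r, hr⟩ := exists_nat_gt (T / Z.τ k Δ i)
    obtain ⟨l, -, hl⟩ := hgrow r
    rw [div_lt_iff₀ hτ] at hr
    exact (EReal.coe_lt_coe_iff.2 hr).not_ge (hl.trans (hcon l))
  · obtain ⟨l, hl, hmem⟩ := hmem 0
    exact h.notMem_comm hpos hl hmem

variable (Z) in
theorem exists_isTrajectory : ∃ x : ℝ → Config n M, Z.IsTrajectory x := by
  have key : ∀ t : ℝ, 0 ≤ t → ∃ l, Z.time l ≤ (t : EReal) ∧ (t : EReal) < Z.time (l + 1) := by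
    intro t ht
    classical
    have hex := h.exists_lt_time Z t
    have hpos : Nat.find hex ≠ 0 := fun h0 => by
      have h1 := Nat.find_spec hex
      rw [h0, Z.time_zero] at h1
      exact (EReal.coe_lt_coe_iff.1 h1).not_ge ht
    obtain ⟨l, hl⟩ := Nat.exists_eq_succ_of_ne_zero hpos
    refine ⟨l, not_lt.1 (Nat.find_min hex (by omega)), ?_⟩
    have h1 := Nat.find_spec hex
    rwa [hl] at h1
  choose! l hl using key
  exact ⟨fun t => (Z.flow (l t) t).x, fun t ht => ⟨l t, (hl t ht).1, (hl t ht).2, rfl⟩⟩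

theorem limsup_distConsensus_le {x : ℝ → Config n M} (hx : Z.IsTrajectory x) :
    limsup (fun t : ℝ => ((distConsensus (x t) ^ 2 : ℝ) : EReal)) atTop
      ≤ ((((M : ℝ) + 1) * S.ξ / (q * lambdaMin S.P) : ℝ) : EReal) := by
  -- For n = 0 the spectrum is empty, `lambdaMin` takes the value 0 and the right side is a division
  -- by zero, hence 0; the distance is 0 too.
  rcases Nat.eq_zero_or_pos n with rfl | hn
  · have h0 : ∀ y : Config 0 M, distConsensus y = 0 := fun y =>
      Metric.infDist_zero_of_mem fun i j => Subsingleton.elim _ _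
    have h1 : lambdaMin S.P = 0 := by
      simp [lambdaMin]
    simp [h0, h1]
  · have : NeZero n := ⟨hn.ne'⟩
    have hlam := lambdaMin_pos h.posDef
    have hq := h.q_pos
    set D := ((M : ℝ) + 1) * S.ξ / q with hD
    have hbound : ∀ t : ℝ, 0 ≤ t → distConsensus (x t) ^ 2
        ≤ (D + Real.exp (-(q * t)) * (S.lyap (Z.flow 0 0) - D)) / lambdaMin S.P := by
      intro t ht
      obtain ⟨l, h1, h2, h3⟩ := hx t ht
      rw [le_div_iff₀ hlam, h3]
      refine le_trans ?_ (h.lyap_le (Z := Z) ⟨h1, h2.le⟩)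
      calc _ ≤ (∑ i, ‖(Z.flow l t).x i - (Z.flow l t).x 0‖ ^ 2) * lambdaMin S.P := by
            gcongr
            exact infDist_consensus_sq_le _
        _ ≤ _ := by
            rw [Finset.sum_mul]
            refine Finset.sum_le_sum fun i _ => ?_
            rw [mul_comm]
            exact lambdaMin_mul_le_bilin h.posDef _
    have hlim : Tendsto (fun t : ℝ => (D + Real.exp (-(q * t)) * (S.lyap (Z.flow 0 0) - D))
        / lambdaMin S.P) atTop (𝓝 (((M : ℝ) + 1) * S.ξ / (q * lambdaMin S.P))) := by
      have h1 : Tendsto (fun t : ℝ => Real.exp (-(q * t))) atTop (𝓝 0) :=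
        Real.tendsto_exp_neg_atTop_nhds_zero.comp (tendsto_id.const_mul_atTop hq)
      have h2 := ((h1.mul_const (S.lyap (Z.flow 0 0) - D)).const_add D).div_const (lambdaMin S.P)
      rwa [zero_mul, add_zero, hD, div_div] at h2
    have hlim' := (continuous_coe_real_ereal.tendsto _).comp hlim
    rw [← hlim'.limsup_eq]
    refine limsup_le_limsup ?_
    filter_upwards [eventually_ge_atTop 0] with t ht
    exact EReal.coe_le_coe_iff.2 (hbound t ht)

end Admissible

end LeaderFollower

end

theorem theorem2 {n m p M : ℕ} (hM : 1 ≤ M) (S : LeaderFollower.System n m p M)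
    -- the vector field and the parameters
    (Ω : Set (LeaderFollower.Vec p)) (hθ : S.θ ∈ Ω) (hθhat : S.θhat ∈ Ω)
    (hf : ContDiffOn ℝ 1
      (fun z : LeaderFollower.Vec n × LeaderFollower.Vec p => S.f z.1 z.2) (Set.univ ×ˢ Ω))
    -- the graph is connected and undirected
    (G : SimpleGraph (Fin (M + 1))) (hG : G.Connected)
    (ha : ∀ i j, 0 ≤ S.a i j) (haG : ∀ i j, 0 < S.a i j ↔ G.Adj i j) (hasymm : S.a.IsSymm)
    (μ : ℝ) (hμ : 0 < μ)
    (hL : (S.L.submatrix Fin.succ Fin.succ - μ • (1 : Matrix (Fin M) (Fin M) ℝ)).PosSemidef)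
    -- stabilisability
    (hP : S.P.PosDef) (q ρ : ℝ) (hq : 0 < q) (hρ : 0 < ρ)
    (hCMF : ∀ θ ∈ Ω, ∀ x, (-(q • S.P) -
      ((LeaderFollower.jacobian (fun y => S.f y θ) x).transpose * S.P
        + S.P * LeaderFollower.jacobian (fun y => S.f y θ) x
        - ρ • (S.P * S.B * S.B.transpose * S.P))).PosSemidef)
    -- Lipschitz continuity and parameter mismatch
    (k Δ : ℝ) (hk : 0 < k) (hΔ : 0 ≤ Δ)
    (hlip : ∀ θ ∈ Ω, ∀ x y, ‖S.f x θ - S.f y θ‖ ≤ k * ‖x - y‖)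
    (hmis : ∀ x, ‖S.f x S.θhat - S.f x S.θ‖ ≤ Δ)
    -- the design parameters
    (hκ₁ : ρ / (2 * μ) < S.κ₁) (hκ₂ : 0 < S.κ₂)
    (hε₀ : 0 ≤ S.ε) (hε : S.ε ≤ 1 / LeaderFollower.lambdaMax S.L)
    (hb₀ : ∀ i, 0 < S.b i) (hb : ∀ i, S.b i < 1 / (2 * S.L i i))
    (hσ₀ : ∀ i, 0 < S.σ i) (hσ : ∀ i, S.σ i < 1) (hξ : 0 < S.ξ)
    (x₀ : LeaderFollower.Config n M) :
    Nonempty (LeaderFollower.Solution S x₀) ∧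
    ∀ Z : LeaderFollower.Solution S x₀,
      -- defined for all positive times, with practical consensus
      (∃ x : ℝ → LeaderFollower.Config n M, Z.IsTrajectory x ∧
        Filter.limsup (fun t : ℝ => ((LeaderFollower.distConsensus (x t) ^ 2 : ℝ) : EReal))
          Filter.atTop
          ≤ ((((M : ℝ) + 1) * S.ξ / (q * LeaderFollower.lambdaMin S.P) : ℝ) : EReal)) ∧
      -- lower bound on the inter-event times
      (∀ i, BddAbove (Z.wValues i) ∧
        (0 < Z.c₁ k Δ i → 0 < Z.τ k Δ i ∧
          ∀ j l : ℕ, j < l → i ∈ Z.comm j → i ∈ Z.comm l →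
            Z.time j + ((Z.τ k Δ i : ℝ) : EReal) ≤ Z.time l) ∧
        -- degenerate case, in which the formula for the bound has no meaning
        (¬ 0 < Z.c₁ k Δ i → ∀ l : ℕ, 0 < l → i ∉ Z.comm l)) := by
  have hloop : ∀ i, S.a i i = 0 := fun i =>
    le_antisymm (not_lt.1 fun hpos => G.loopless.irrefl i ((haG i i).1 hpos)) (ha i i)
  -- A connected graph on at least two vertices has no isolated vertex.
  have hdeg : ∀ i, 0 < S.L i i := by
    intro i
    have : Nontrivial (Fin (M + 1)) := Fin.nontrivial_iff_two_le.2 (by omega)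
    obtain ⟨j, hj⟩ := hG.preconnected.exists_adj_of_nontrivial i
    have h1 : S.L i i = ∑ j, S.a i j := by simp [LeaderFollower.System.L, LeaderFollower.laplacian]
    rw [h1]
    exact Finset.sum_pos' (fun j _ => ha i j) ⟨j, Finset.mem_univ j, (haG i j).2 hj⟩
  have hsm := S.contDiff_slice hf hθ
  have hsm' := S.contDiff_slice hf hθhat
  have h : LeaderFollower.Admissible S μ q ρ k Δ :=
    { symm := hasymm, loopless := hloop, weight_nonneg := ha, degree_pos := hdeg, grounded := hL
      posDef := hP, μ_pos := hμ, q_pos := hq, ρ_pos := hρ, k_pos := hk, Δ_nonneg := hΔ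
      smooth := hsm, smooth_hat := hsm'
      incremental := LeaderFollower.incremental_of_jacobian hP.isSymm_real
        (hsm.differentiable one_ne_zero) (hCMF _ hθ)
      incremental_hat := LeaderFollower.incremental_of_jacobian hP.isSymm_real
        (hsm'.differentiable one_ne_zero) (hCMF _ hθhat)
      lip := hlip _ hθ, lip_hat := hlip _ hθhat, mismatch := hmis, κ₁_gt := hκ₁, κ₂_pos := hκ₂
      ε_nonneg := hε₀, ε_le := hε, b_pos := hb₀, b_lt := hb, σ_pos := hσ₀, σ_lt := hσ
      ξ_pos := hξ }
  refine ⟨h.nonempty_solution x₀, fun Z => ⟨?_, fun i => ⟨h.bddAbove_wValues Z i,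
    fun hc => ⟨h.τ_pos hc, fun j l hjl hj hl => h.time_add_τ_le hc hjl hj hl⟩,
    fun hc l hl => h.notMem_comm hc hl⟩⟩⟩
  obtain ⟨x, hx⟩ := h.exists_isTrajectory Z
  exact ⟨x, hx, h.limsup_distConsensus_le hx⟩
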